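/- Let $n\ge 1$ and let $M=\Gamma\backslash G$ be a Lie-Hermitian manifold of complex dimension $n$: $G$ is a real Lie group of dimension $2n$ equipped with a left-invariant (integrable) complex structure $J$ and a compatible left-invariant metric $g=\langle\cdot,\cdot\rangle$, and $\Gamma\subset G$ is a discrete subgroup, acting on $G$ by left translations, with compact quotient $M$; the structure $(J,g)$ descends to $M$. Equivalently, on the Lie algebra $\mathfrak g$ of $G$ one is given a linear map $J$ with $J^2=-1$ and $[x,y]-[Jx,Jy]+J[Jx,y]+J[x,Jy]=0$, and an inner product with $\langle Jx,Jy\rangle=\langle x,y\rangle$, for all $x,y\in\mathfrak g$. Assume that $\mathfrak g$ satisfies at least one of the following conditions, where $\mathfrak g'=[\mathfrak g,\mathfrak g]$: (i) $\mathfrak g$ is nilpotent; (ii) $\mathfrak g$ is solvable and $J\mathfrak g'=\mathfrak g'$; (iii) $\mathfrak g$ is unimodular (that is, $\operatorname{tr}(\operatorname{ad}_x)=0$ for all $x\in\mathfrak g$) and contains an abelian ideal of codimension $1$; (iv) $\mathfrak g$ is unimodular and contains an abelian ideal $\mathfrak a$ of codimension $2$ with $J\mathfrak a=\mathfrak a$.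 Let $R$ be the curvature tensor of the Chern connection of $g$, that is, of the connection that preserves $g$ and $J$ and whose torsion has vanishing $(1,1)$-part, with $R$ and $g$ extended $\mathbb C$-multilinearly to complex tangent vectors. For a nonzero $(1,0)$-vector $X$ put $H(X)=R(X,\overline X,X,\overline X)/|X|^4$, where $|X|^2=\langle X,\overline X\rangle$, and $\operatorname{Ric}(X,\overline X)=\sum_{i=1}^n R(X,\overline X,e_i,\overline e_i)$ for any unitary frame $e_1,\dots,e_n$ of $(1,0)$-vectors. Let $\alpha,\beta\in\mathbb R$ with $(\alpha,\beta)\neq(0,0)$, and suppose that the mixed curvature is constant, i.e. there is $c\in\mathbb R$ such that $$\mathcal C_{\alpha,\beta}(X)=\alpha\operatorname{Ric}(X,\overline X)+\beta H(X)=c$$ for every $(1,0)$-vector $X$ of unit length. Then $c=0$. If moreover $\beta\neq 0$, then $g$ is Chern flat, i.e. $R=0$. -/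

import Mathlib

open scoped Manifold ContDiff

noncomputable section

/-! ## Hermitian Lie algebras -/

section LieAlgebra

variable (𝔤 : Type*) [LieRing 𝔤] [LieAlgebra ℝ 𝔤]

/-- A Hermitian structure `(J, g)` on a real Lie algebra: an integrable complex structure `J`
together with an inner product `g` for which `J` is orthogonal. -/
structure HermitianStructure where
  J : 𝔤 →ₗ[ℝ] 𝔤
  metric : LinearMap.BilinForm ℝ 𝔤
  J_J : ∀ x, J (J x) = -x
  integrable : ∀ x y, ⁅x, y⁆ - ⁅J x, J y⁆ + J ⁅J x, y⁆ + J ⁅x, J y⁆ = 0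
  metric_symm : ∀ x y, metric x y = metric y x
  metric_pos : ∀ x, x ≠ 0 → 0 < metric x x
  metric_J : ∀ x y, metric (J x) (J y) = metric x y

/-- `tr (ad x) = 0` for all `x`. -/
def IsUnimodularLieAlgebra : Prop :=
  ∀ x : 𝔤, LinearMap.trace ℝ 𝔤 (LieAlgebra.ad ℝ 𝔤 x) = 0

/-- The Lie algebra contains an abelian ideal of codimension one. -/
def IsAlmostAbelian : Prop :=
  ∃ 𝔞 : LieIdeal ℝ 𝔤, IsLieAbelian 𝔞 ∧
    Module.finrank ℝ 𝔞 + 1 = Module.finrank ℝ 𝔤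

/-- The commutator `𝔤' = [𝔤, 𝔤]`. -/
def commutatorIdeal : LieIdeal ℝ 𝔤 := ⁅(⊤ : LieIdeal ℝ 𝔤), (⊤ : LieIdeal ℝ 𝔤)⁆

variable {𝔤}

namespace HermitianStructure

/-- `J 𝔤' = 𝔤'`. -/
def HasComplexCommutator (h : HermitianStructure 𝔤) : Prop :=
  (commutatorIdeal 𝔤).toSubmodule.map h.J = (commutatorIdeal 𝔤).toSubmodule

/-- There is an abelian ideal `𝔞` of codimension two with `J 𝔞 = 𝔞`. -/
def HasComplexAbelianIdealOfCodimTwo (h : HermitianStructure 𝔤) : Prop :=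
  ∃ 𝔞 : LieIdeal ℝ 𝔤, IsLieAbelian 𝔞 ∧
    Module.finrank ℝ 𝔞 + 2 = Module.finrank ℝ 𝔤 ∧
    𝔞.toSubmodule.map h.J = 𝔞.toSubmodule

end HermitianStructure

end LieAlgebra

/-! ## Complexification of a real vector space

The complex vector `a + √-1 b` of `V ⊗ ℂ` is represented by the pair `(a, b)`. -/

section Complexification

variable {V : Type*}

/-- Complex conjugation `a + √-1 b ↦ a - √-1 b`. -/
def conjVector [Neg V] (X : V × V) : V × V := (X.1, -X.2)

/-- The `ℂ`-linear extension to `V ⊗ ℂ` of an `ℝ`-linear function `f` on `V`. -/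
def complexExtend (f : V → ℂ) (X : V × V) : ℂ := f X.1 + Complex.I * f X.2

/-- The `ℂ`-bilinear extension of a real bilinear form. -/
def complexExtend₂ (f : V → V → ℝ) (X Y : V × V) : ℂ :=
  complexExtend (fun x => complexExtend (fun y => (f x y : ℂ)) Y) X

/-- The `ℂ`-multilinear extension of a real 4-linear form. -/
def complexExtend₄ (f : V → V → V → V → ℝ) (X Y Z W : V × V) : ℂ :=
  complexExtend (fun x => complexExtend (fun y => complexExtend₂ (f x y) Z W) Y) X

end Complexification

/-! ## Left-invariant Hermitian geometry on a Lie group -/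

section LieGroup

variable {E : Type*} [NormedAddCommGroup E] [NormedSpace ℝ E]
  {G : Type*} [TopologicalSpace G] [ChartedSpace E G] [Group G]

instance lieGroup_minSmoothness_of_smooth [LieGroup 𝓘(ℝ, E) ∞ G] :
    LieGroup 𝓘(ℝ, E) (minSmoothness ℝ 3) G :=
  LieGroup.of_le (n := ∞) (by
    rw [minSmoothness_of_isRCLikeNormedField]
    exact WithTop.coe_le_coe.2 (le_top : (3 : ℕ∞) ≤ ⊤))

/-- The Maurer-Cartan form: it sends a tangent vector `u` at `x` to the element of the Lie algebra
whose left-invariant vector field takes the value `u` at `x`. -/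
def maurerCartan (x : G) (u : TangentSpace 𝓘(ℝ, E) x) : GroupLieAlgebra 𝓘(ℝ, E) G :=
  (mfderiv 𝓘(ℝ, E) 𝓘(ℝ, E) (fun y : G => x * y) (1 : G)).inverse u

variable [LieGroup 𝓘(ℝ, E) ∞ G]

/-- The curvature `R(X, Y) Z = ∇_X ∇_Y Z - ∇_Y ∇_X Z - ∇_[X, Y] Z` of a connection, on vector fields.
Recall that `D Z x (X x)` is the value of `∇_X Z` at `x`. -/
def curvatureOnFields
    (D : CovariantDerivative 𝓘(ℝ, E) E (TangentSpace 𝓘(ℝ, E) : G → Type _))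
    (X Y Z : Π x : G, TangentSpace 𝓘(ℝ, E) x) (x : G) : TangentSpace 𝓘(ℝ, E) x :=
  D (fun y => D Z y (Y y)) x (X x) - D (fun y => D Z y (X y)) x (Y x) -
    D Z x (VectorField.mlieBracket 𝓘(ℝ, E) X Y x)

variable [CompleteSpace E]

namespace HermitianStructure

variable (h : HermitianStructure (GroupLieAlgebra 𝓘(ℝ, E) G))

/-- The left-invariant complex structure on `G` determined by `J`, at the point `x`. -/
def leftJ (x : G) (u : TangentSpace 𝓘(ℝ, E) x) : TangentSpace 𝓘(ℝ, E) x :=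
  mulInvariantVectorField (h.J (maurerCartan x u)) x

/-- The left-invariant metric on `G` determined by the inner product, at the point `x`. -/
def leftMetric (x : G) (u v : TangentSpace 𝓘(ℝ, E) x) : ℝ :=
  h.metric (maurerCartan x u) (maurerCartan x v)

/-- `D` is the Chern connection of the left-invariant Hermitian structure on `G`: the connection on
the tangent bundle for which the metric and the complex structure are parallel and whose torsion
has no `(1,1)`-part, i.e. `T(X, Ȳ) = 0` for `X`, `Y` of type `(1,0)`; in real terms,
`T(Ju, Jv) = -T(u, v)`. -/
structure IsChernConnection [FiniteDimensional ℝ E]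
    (D : CovariantDerivative 𝓘(ℝ, E) E (TangentSpace 𝓘(ℝ, E) : G → Type _)) : Prop where
  metric_parallel : ∀ (Y Z : Π x : G, TangentSpace 𝓘(ℝ, E) x) (x : G),
    MDiffAt (T% Y) x → MDiffAt (T% Z) x → ∀ v : TangentSpace 𝓘(ℝ, E) x,
      mvfderiv 𝓘(ℝ, E) (fun y => h.leftMetric y (Y y) (Z y)) x v =
        h.leftMetric x (D Y x v) (Z x) + h.leftMetric x (Y x) (D Z x v)
  J_parallel : ∀ (Y : Π x : G, TangentSpace 𝓘(ℝ, E) x) (x : G),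
    MDiffAt (T% Y) x → ∀ v : TangentSpace 𝓘(ℝ, E) x,
      D (fun y => h.leftJ y (Y y)) x v = h.leftJ x (D Y x v)
  torsion_J_J : ∀ (x : G) (u v : TangentSpace 𝓘(ℝ, E) x),
    D.torsion x (h.leftJ x u) (h.leftJ x v) = -D.torsion x u v

variable (D : CovariantDerivative 𝓘(ℝ, E) E (TangentSpace 𝓘(ℝ, E) : G → Type _))

/-- The curvature tensor `R(u, v, w, z) = g(R(u, v) w, z)` at `x`. Curvature being tensorial, it is
evaluated by extending the tangent vectors at `x` to left-invariant vector fields. -/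
def curvatureTensor (x : G) (u v w z : TangentSpace 𝓘(ℝ, E) x) : ℝ :=
  h.leftMetric x
    (curvatureOnFields D (mulInvariantVectorField (maurerCartan x u))
      (mulInvariantVectorField (maurerCartan x v))
      (mulInvariantVectorField (maurerCartan x w)) x) z

/-- The metric at `x`, extended `ℂ`-bilinearly to complex tangent vectors. -/
def complexMetric (x : G) :
    (TangentSpace 𝓘(ℝ, E) x × TangentSpace 𝓘(ℝ, E) x) →
    (TangentSpace 𝓘(ℝ, E) x × TangentSpace 𝓘(ℝ, E) x) → ℂ :=
  complexExtend₂ (h.leftMetric x)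

/-- The curvature tensor at `x`, extended `ℂ`-multilinearly to complex tangent vectors. -/
def complexCurvature (x : G) :
    (TangentSpace 𝓘(ℝ, E) x × TangentSpace 𝓘(ℝ, E) x) →
    (TangentSpace 𝓘(ℝ, E) x × TangentSpace 𝓘(ℝ, E) x) →
    (TangentSpace 𝓘(ℝ, E) x × TangentSpace 𝓘(ℝ, E) x) →
    (TangentSpace 𝓘(ℝ, E) x × TangentSpace 𝓘(ℝ, E) x) → ℂ :=
  complexExtend₄ (h.curvatureTensor D x)

/-- The complex tangent vector `X` at `x` is of type `(1,0)`, i.e. `X = u - √-1 J u`. -/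
def IsTypeOneZero (x : G) (X : TangentSpace 𝓘(ℝ, E) x × TangentSpace 𝓘(ℝ, E) x) : Prop :=
  X.2 = -h.leftJ x X.1

/-- `e₁, …, eₙ` are unitary vectors of type `(1,0)` at `x`: `g(eᵢ, ēⱼ) = δᵢⱼ`. When `dim G = 2n`,
these form a basis of the space of `(1,0)`-vectors at `x`. -/
def IsUnitaryFrame {n : ℕ} (x : G)
    (e : Fin n → TangentSpace 𝓘(ℝ, E) x × TangentSpace 𝓘(ℝ, E) x) : Prop :=
  (∀ i, h.IsTypeOneZero x (e i)) ∧
    ∀ i j, h.complexMetric x (e i) (conjVector (e j)) = if i = j then 1 else 0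

/-- The first Ricci curvature `Ric(X, Ȳ) = ∑ᵢ R(X, Ȳ, eᵢ, ēᵢ)`, computed in the frame `e`. -/
def ricci {n : ℕ} (x : G) (e : Fin n → TangentSpace 𝓘(ℝ, E) x × TangentSpace 𝓘(ℝ, E) x)
    (X Y : TangentSpace 𝓘(ℝ, E) x × TangentSpace 𝓘(ℝ, E) x) : ℂ :=
  ∑ i, h.complexCurvature D x X (conjVector Y) (e i) (conjVector (e i))

/-- The holomorphic sectional curvature `H(X) = R(X, X̄, X, X̄) / |X|⁴`. -/
def holomorphicSectionalCurvature (x : G)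
    (X : TangentSpace 𝓘(ℝ, E) x × TangentSpace 𝓘(ℝ, E) x) : ℂ :=
  h.complexCurvature D x X (conjVector X) X (conjVector X) /
    h.complexMetric x X (conjVector X) ^ 2

/-- The mixed curvature of `D` is constantly `c`: `α Ric(X, X̄) + β H(X) = c` for every point `x` and
every `(1,0)`-vector `X` of unit length at `x`, the Ricci curvature being computed in any unitary
frame. -/
def HasConstantMixedCurvature (n : ℕ) (α β c : ℝ) : Prop :=
  ∀ (x : G) (e : Fin n → TangentSpace 𝓘(ℝ, E) x × TangentSpace 𝓘(ℝ, E) x),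
    h.IsUnitaryFrame x e →
    ∀ X : TangentSpace 𝓘(ℝ, E) x × TangentSpace 𝓘(ℝ, E) x,
      h.IsTypeOneZero x X → h.complexMetric x X (conjVector X) = 1 →
      (α : ℂ) * h.ricci D x e X X + (β : ℂ) * h.holomorphicSectionalCurvature D x X = (c : ℂ)

/-- The curvature tensor of `D` vanishes identically. -/
def IsFlat : Prop :=
  ∀ (x : G) (u v w z : TangentSpace 𝓘(ℝ, E) x), h.curvatureTensor D x u v w z = 0

end HermitianStructure

end LieGroup

end

open scoped RealInnerProductSpace

/-! ## Families of operators on a Hermitian vector space -/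

section Family

variable {V : Type*} [NormedAddCommGroup V] [InnerProductSpace ℝ V]

/-! Everything reduces to the Lie algebra. Put `L x y = [x, y] + J [J x, y]` (`bottFamily`).
Integrability makes `L` complex linear in `y` and antilinear in `x`, and Jacobi gives `L x L y - L y
L x = L ([x, y] - [J x, J y])`. On left-invariant fields the Chern connection is the skew part `(L x
- (L x)*) / 2`, so that `2 J R(x, J x) = [L x, (L x)*] - L (L x x) - (L (L x x))*`. Constant mixed
curvature becomes a homogeneous identity, `-α tr (L (L x x)) |x|² + β q(x) = 2c |x|⁴` with `q =
quarticForm L` (`mixedCurvature_homogeneous`). Flatness follows once `L` kills all brackets and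
every `L x` is normal, for then all the `L x` and their adjoints commute (`chernCurvature_eq_zero`).

Cases (i) and (ii). A proper complex subspace `N` containing all brackets acts nilpotently, so the
trace vanishes and, for `β ≠ 0`, `q = k |x|⁴`. On the orthogonal of `N` one has `q ≤ 0`, while `q ≥
0` at a vector of `N` killed by all `L n`, `n ∈ N`; hence `k = 0`. The second variation of `q` at
such vectors, summed over orthonormal bases, shows that they span a subspace stable under all `(L
x)*`, that `L` vanishes there in its first argument, and that every `L x` is normal there. Repeating
this on orthogonal complements exhausts `N` (`normal_of_nilpotent`).

Cases (iii) and (iv). If `𝔞` is abelian of codimension one, `𝔞 ∩ J 𝔞` is a complex abelian ideal of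
codimension two, so (iii) reduces to (iv). There `L` is encoded by `L e e = b e + v` and the
operators `A = L e`, `T w = L w e` of `𝔞`. The coefficients in `s` of the identity at `x = e + s w`
give relations between these data; unimodularity and Jacobi add `tr T² = 2 b (b + tr A)`
(`trace_right_sq`). The top coefficient leads to `T` being skew, a sum of squares then forces `b =
0`, `v = 0`, `T = 0`, and what remains says that `A` is normal (`IsCodimTwoFamily.rigid`). -/

lemma quartic_coeff_eq_zero {a₀ a₁ a₂ a₃ a₄ : ℝ}
    (h : ∀ s : ℝ, a₀ + a₁ * s + a₂ * s ^ 2 + a₃ * s ^ 3 + a₄ * s ^ 4 = 0) :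
    a₀ = 0 ∧ a₁ = 0 ∧ a₂ = 0 ∧ a₃ = 0 ∧ a₄ = 0 := by
  have h0 := h 0
  have h1 := h 1
  have h2 := h (-1)
  have h3 := h 2
  have h4 := h (-2)
  norm_num at h0 h1 h2 h3 h4
  refine ⟨?_, ?_, ?_, ?_, ?_⟩ <;> linarith

/-- `J` is an orthogonal complex structure on `V`, and `L` is a family of `J`-linear operators
depending `J`-antilinearly on the parameter. -/
structure IsAntilinearFamily (J : V →ₗ[ℝ] V) (L : V →ₗ[ℝ] V →ₗ[ℝ] V) : Prop where
  J_J : ∀ x, J (J x) = -x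
  inner_J_J : ∀ x y, ⟪J x, J y⟫ = ⟪x, y⟫
  map_J : ∀ x y, L x (J y) = J (L x y)
  J_left : ∀ x y, L (J x) y = -J (L x y)

namespace IsAntilinearFamily

variable {J : V →ₗ[ℝ] V} {L : V →ₗ[ℝ] V →ₗ[ℝ] V}

lemma inner_J_left (h : IsAntilinearFamily J L) (x y : V) : ⟪J x, y⟫ = -⟪x, J y⟫ := by
  have := h.inner_J_J x (J y)
  rw [h.J_J, inner_neg_right] at this
  linarith

lemma norm_J (h : IsAntilinearFamily J L) (x : V) : ‖J x‖ = ‖x‖ := by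
  have := h.inner_J_J x x
  rw [real_inner_self_eq_norm_sq, real_inner_self_eq_norm_sq] at this
  exact (sq_eq_sq₀ (norm_nonneg _) (norm_nonneg _)).1 this

end IsAntilinearFamily

variable [FiniteDimensional ℝ V]

/-- The family of the adjoint operators. -/
noncomputable def adjointFamily (L : V →ₗ[ℝ] V →ₗ[ℝ] V) : V →ₗ[ℝ] V →ₗ[ℝ] V :=
  LinearMap.mk₂ ℝ (fun x y => LinearMap.adjoint (L x) y) (by simp) (by simp) (by simp) (by simp)

lemma adjointFamily_apply (L : V →ₗ[ℝ] V →ₗ[ℝ] V) (x : V) :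
    adjointFamily L x = LinearMap.adjoint (L x) := rfl

lemma inner_adjointFamily_left (L : V →ₗ[ℝ] V →ₗ[ℝ] V) (x y z : V) :
    ⟪adjointFamily L x y, z⟫ = ⟪y, L x z⟫ := by
  rw [adjointFamily_apply, LinearMap.adjoint_inner_left]

lemma inner_adjointFamily_right (L : V →ₗ[ℝ] V →ₗ[ℝ] V) (x y z : V) :
    ⟪y, adjointFamily L x z⟫ = ⟪L x y, z⟫ := by
  rw [adjointFamily_apply, LinearMap.adjoint_inner_right]

/-- The quartic form which, for the family associated with a Hermitian Lie algebra, computes the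
holomorphic sectional curvature. -/
noncomputable def quarticForm (L : V →ₗ[ℝ] V →ₗ[ℝ] V) (x : V) : ℝ :=
  ‖adjointFamily L x x‖ ^ 2 - ‖L x x‖ ^ 2 - 2 * ⟪L (L x x) x, x⟫

lemma sum_norm_sq_adjoint {ι : Type*} [Fintype ι] (b : OrthonormalBasis ι ℝ V) (T : V →ₗ[ℝ] V) :
    ∑ i, ‖LinearMap.adjoint T (b i)‖ ^ 2 = ∑ i, ‖T (b i)‖ ^ 2 := by
  have h1 : ∑ i, ‖LinearMap.adjoint T (b i)‖ ^ 2 =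
      LinearMap.trace ℝ V (T * LinearMap.adjoint T) := by
    rw [LinearMap.trace_eq_sum_inner _ b]
    refine Finset.sum_congr rfl fun i _ => ?_
    rw [← real_inner_self_eq_norm_sq, LinearMap.adjoint_inner_left]; rfl
  have h2 : ∑ i, ‖T (b i)‖ ^ 2 = LinearMap.trace ℝ V (LinearMap.adjoint T * T) := by
    rw [LinearMap.trace_eq_sum_inner _ b]
    refine Finset.sum_congr rfl fun i _ => ?_
    rw [← real_inner_self_eq_norm_sq, ← LinearMap.adjoint_inner_right]; rfl
  rw [h1, h2, LinearMap.trace_mul_comm]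

/-- The compression of `T*` to an invariant subspace is the adjoint of the restriction of `T`, so
both have the same Hilbert–Schmidt norm. -/
lemma sum_norm_sq_adjoint_restrict {ι : Type*} [Fintype ι] {E : Submodule ℝ V}
    (b : OrthonormalBasis ι ℝ E) (T : V →ₗ[ℝ] V) (hT : ∀ e ∈ E, T e ∈ E) :
    ∑ i, ‖E.starProjection (LinearMap.adjoint T (b i))‖ ^ 2 = ∑ i, ‖T (b i)‖ ^ 2 := by
  have := sum_norm_sq_adjoint b (T.restrict hT)
  have key : ∀ e : E, ((LinearMap.adjoint (T.restrict hT) e : E) : V) =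
      E.starProjection (LinearMap.adjoint T e) := by
    intro e
    symm
    apply Submodule.eq_starProjection_of_mem_of_inner_eq_zero (by simp)
    intro w hw
    have h1 : ⟪LinearMap.adjoint (T.restrict hT) e, (⟨w, hw⟩ : E)⟫ = ⟪e, (T.restrict hT) ⟨w, hw⟩⟫ :=
      LinearMap.adjoint_inner_left _ _ _
    rw [inner_sub_left, LinearMap.adjoint_inner_left]
    simp only [Submodule.coe_inner, LinearMap.coe_restrict_apply] at h1
    rw [h1]; simp
  simp only [← Submodule.coe_norm, ← key] at this ⊢
  rw [this]; rfl

namespace IsAntilinearFamily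

variable {J : V →ₗ[ℝ] V} {L : V →ₗ[ℝ] V →ₗ[ℝ] V}

lemma adjoint_map_J (h : IsAntilinearFamily J L) (x y : V) :
    adjointFamily L x (J y) = J (adjointFamily L x y) := by
  refine ext_inner_right ℝ fun z => ?_
  rw [inner_adjointFamily_left, h.inner_J_left, h.inner_J_left, inner_adjointFamily_left, h.map_J]

lemma adjoint_J_left (h : IsAntilinearFamily J L) (x y : V) :
    adjointFamily L (J x) y = J (adjointFamily L x y) := by
  refine ext_inner_right ℝ fun z => ?_
  rw [inner_adjointFamily_left, h.inner_J_left, inner_adjointFamily_left, h.J_left, h.map_J,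
    inner_neg_right]

/-- If all the operators `L x` are normal, then they commute with all the adjoints. -/
lemma commute_adjoint_of_normal (h : IsAntilinearFamily J L)
    (hn : ∀ x z, L x (adjointFamily L x z) = adjointFamily L x (L x z)) (x y z : V) :
    L x (adjointFamily L y z) = adjointFamily L y (L x z) := by
  have key : ∀ x y z, L x (adjointFamily L y z) + L y (adjointFamily L x z) =
      adjointFamily L y (L x z) + adjointFamily L x (L y z) := by
    intro x y z
    have := hn (x + y) z
    simp only [map_add, LinearMap.add_apply] at this
    have hx := hn x z
    have hy := hn y z
    rw [hx, hy] at this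
    have h3 := sub_eq_zero.2 this
    rw [← sub_eq_zero, ← h3]; abel
  have h1 := key x y z
  -- `L` is antilinear and its adjoint linear in the parameter, so replacing `y` by `J y` flips the
  -- relative sign of the two terms on each side.
  have h2 := key x (J y) z
  simp only [h.adjoint_J_left, h.map_J, h.J_left, map_neg, h.adjoint_map_J] at h2
  have h3 : L x (adjointFamily L y z) - L y (adjointFamily L x z) =
      adjointFamily L y (L x z) - adjointFamily L x (L y z) := by
    have := congrArg J h2
    simp only [map_add, map_neg, h.J_J] at this
    rw [← sub_eq_zero] at this ⊢
    rw [← neg_eq_zero, ← this]; abel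
  have h4 := congrArg₂ (· + ·) h1 h3
  have h5 : (2 : ℝ) • L x (adjointFamily L y z) = (2 : ℝ) • adjointFamily L y (L x z) := by
    rw [two_smul, two_smul]
    rw [← sub_eq_zero] at h4 ⊢
    rw [← h4]; abel
  exact smul_right_injective V two_ne_zero h5

/-- The coefficient of `s²` in `q (e + s x) = 0`, averaged over `x` and `J x`. The average removes
the terms of the wrong type, `⟪L e x, L x e⟫` and `⟪L (L x e) x, e⟫`. -/
lemma second_variation (h : IsAntilinearFamily J L) (hq : ∀ x, quarticForm L x = 0) {e : V}
    (he : L e e = 0)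
    (hE : ∀ x y, L (L x y) e = 0) (x : V) :
    ‖adjointFamily L e x‖ ^ 2 - ‖L e x‖ ^ 2 + ‖adjointFamily L x e‖ ^ 2 - ‖L x e‖ ^ 2
      + 2 * ⟪adjointFamily L e x, adjointFamily L x e⟫ - 2 * ⟪L (L e x) x, e⟫ = 0 := by
  have hae : adjointFamily L e e = 0 := by
    have := hq e
    simp only [quarticForm, he, map_zero, LinearMap.zero_apply, inner_zero_left, norm_zero] at this
    simpa using this
  have star : ∀ x, ‖adjointFamily L e x + adjointFamily L x e‖ ^ 2 - ‖L e x + L x e‖ ^ 2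
      - 2 * ⟪L (L e x) x + L (L x e) x, e⟫ = 0 := by
    intro x
    have h1 : ∀ s : ℝ, 0 + 0 * s +
        (‖adjointFamily L e x + adjointFamily L x e‖ ^ 2 - ‖L e x + L x e‖ ^ 2
          - 2 * ⟪L (L e x) x + L (L x e) x, e⟫) * s ^ 2 +
        (2 * ⟪adjointFamily L e x + adjointFamily L x e, adjointFamily L x x⟫
          - 2 * ⟪L e x + L x e, L x x⟫
          - 2 * ⟪L (L e x) x + L (L x e) x, x⟫ - 2 * ⟪L (L x x) x, e⟫) * s ^ 3 +
        (‖adjointFamily L x x‖ ^ 2 - ‖L x x‖ ^ 2 - 2 * ⟪L (L x x) x, x⟫) * s ^ 4 = 0 := by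
      intro s
      refine Eq.trans ?_ (hq (e + s • x))
      simp only [quarticForm, ← real_inner_self_eq_norm_sq, map_add, map_smul,
        LinearMap.add_apply, LinearMap.smul_apply, he, hae, hE, zero_add, add_zero, smul_zero,
        inner_add_left, inner_add_right, real_inner_smul_left, real_inner_smul_right, smul_add]
      simp only [real_inner_comm (L e x) (L x e), real_inner_comm (L e x) (L x x),
        real_inner_comm (L x e) (L x x),
        real_inner_comm (adjointFamily L e x) (adjointFamily L x e),
        real_inner_comm (adjointFamily L e x) (adjointFamily L x x),
        real_inner_comm (adjointFamily L x e) (adjointFamily L x x)]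
      ring
    exact (quartic_coeff_eq_zero h1).2.2.1
  have h1 := star x
  have h2 := star (J x)
  simp only [h.map_J, h.J_left, h.adjoint_map_J, h.adjoint_J_left, map_neg, LinearMap.neg_apply,
    h.J_J, neg_neg] at h2
  rw [← map_add, ← sub_eq_add_neg, ← map_sub, h.norm_J, h.norm_J] at h2
  simp only [← real_inner_self_eq_norm_sq, inner_add_left, inner_add_right, inner_sub_left,
    inner_sub_right, inner_neg_left] at h1 h2 ⊢
  rw [real_inner_comm (L e x) (L x e),
    real_inner_comm (adjointFamily L e x) (adjointFamily L x e)] at h1 h2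
  linarith

end IsAntilinearFamily

/-- Both sums are traces of the same two operators, multiplied in opposite orders. This cancels the
mixed terms of the second variation after summation over a basis. -/
lemma sum_cross_terms {ι : Type*} [Fintype ι] (b : OrthonormalBasis ι ℝ V)
    (L : V →ₗ[ℝ] V →ₗ[ℝ] V) (e : V) :
    ∑ i, ⟪adjointFamily L e (b i), adjointFamily L (b i) e⟫ = ∑ i, ⟪L (L e (b i)) (b i), e⟫ := by
  have h1 : ∑ i, ⟪adjointFamily L e (b i), adjointFamily L (b i) e⟫ =
      LinearMap.trace ℝ V (L e * (adjointFamily L).flip e) := by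
    rw [LinearMap.trace_eq_sum_inner _ b]
    refine Finset.sum_congr rfl fun i _ => ?_
    rw [inner_adjointFamily_left]; rfl
  have h2 : ∑ i, ⟪L (L e (b i)) (b i), e⟫ =
      LinearMap.trace ℝ V ((adjointFamily L).flip e * L e) := by
    rw [LinearMap.trace_eq_sum_inner _ b]
    refine Finset.sum_congr rfl fun i _ => ?_
    rw [← inner_adjointFamily_right]; rfl
  rw [h1, h2, LinearMap.trace_mul_comm]

end Family

/-! ## Families acting nilpotently along a subspace -/

section NilpotentFamily

variable {V : Type*} [NormedAddCommGroup V] [InnerProductSpace ℝ V]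
  {J : V →ₗ[ℝ] V} {L : V →ₗ[ℝ] V →ₗ[ℝ] V}

/-- `F` is a filtration, starting with a subspace containing `N` and ending with zero, which is
shifted by all the operators `L n` with `n ∈ N`. -/
structure IsNilpotentFiltration (L : V →ₗ[ℝ] V →ₗ[ℝ] V) (N : Submodule ℝ V)
    (F : ℕ → Submodule ℝ V) : Prop where
  le_zero : N ≤ F 0
  shift : ∀ k, ∀ n ∈ N, ∀ y ∈ F k, L n y ∈ F (k + 1)
  eventually_bot : ∃ k, F k = ⊥

/-- The last step of the filtration that meets `W` nontrivially is sent by each `L n` into the next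
one, which meets `W` in zero. -/
lemma IsNilpotentFiltration.exists_common_kernel {N : Submodule ℝ V} {F : ℕ → Submodule ℝ V}
    (hF : IsNilpotentFiltration L N F) {W : Submodule ℝ V} (hW : W ≠ ⊥) (hWN : W ≤ N)
    (hinv : ∀ n ∈ N, ∀ w ∈ W, L n w ∈ W) :
    ∃ e ∈ W, e ≠ 0 ∧ ∀ n ∈ N, L n e = 0 := by
  classical
  have hex : ∃ k, W ⊓ F k = ⊥ := by
    obtain ⟨k, hk⟩ := hF.eventually_bot
    exact ⟨k, by rw [hk, inf_bot_eq]⟩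
  obtain ⟨k, hk⟩ : ∃ k, Nat.find hex = k + 1 := by
    refine Nat.exists_eq_succ_of_ne_zero fun h0 => hW ?_
    have := Nat.find_spec hex
    rw [h0, inf_eq_left.2 (hWN.trans hF.le_zero)] at this
    exact this
  have hne : W ⊓ F k ≠ ⊥ := Nat.find_min hex (by omega)
  have hbot : W ⊓ F (k + 1) = ⊥ := hk ▸ Nat.find_spec hex
  obtain ⟨e, he, he0⟩ := Submodule.exists_mem_ne_zero_of_ne_bot hne
  refine ⟨e, he.1, he0, fun n hn => ?_⟩
  have : L n e ∈ W ⊓ F (k + 1) := ⟨hinv n hn e he.1, hF.shift k n hn e he.2⟩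
  rwa [hbot, Submodule.mem_bot] at this

lemma IsNilpotentFiltration.isNilpotent {N : Submodule ℝ V} {F : ℕ → Submodule ℝ V}
    (hF : IsNilpotentFiltration L N F) (hLN : ∀ x y, L x y ∈ N) {n : V} (hn : n ∈ N) :
    IsNilpotent (L n) := by
  obtain ⟨k, hk⟩ := hF.eventually_bot
  refine ⟨k + 1, LinearMap.ext fun x => ?_⟩
  have : ∀ m, ((L n) ^ (m + 1)) x ∈ F m := by
    intro m
    induction m with
    | zero => simpa using hF.le_zero (hLN n x)
    | succ m ih =>
      rw [pow_succ', Module.End.mul_apply]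
      exact hF.shift m n hn _ ih
  have := this k
  rwa [hk, Submodule.mem_bot] at this

variable [FiniteDimensional ℝ V]

/-- A subspace `K` of `N` such that `L` vanishes on `K` in the first variable and such that all the
operators `L x` restrict to normal operators of `K`. -/
structure IsNormalKernel (L : V →ₗ[ℝ] V →ₗ[ℝ] V) (N K : Submodule ℝ V) : Prop where
  le : K ≤ N
  left_eq_zero : ∀ z ∈ K, L z = 0
  mem : ∀ z ∈ K, ∀ x, L x z ∈ K
  adjoint_mem : ∀ z ∈ K, ∀ x, adjointFamily L x z ∈ K
  normal : ∀ z ∈ K, ∀ x, L x (adjointFamily L x z) = adjointFamily L x (L x z)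

lemma IsNormalKernel.bot (L : V →ₗ[ℝ] V →ₗ[ℝ] V) (N : Submodule ℝ V) : IsNormalKernel L N ⊥ := by
  constructor <;> simp

lemma IsNormalKernel.sup {N K K' : Submodule ℝ V} (h : IsNormalKernel L N K)
    (h' : IsNormalKernel L N K') : IsNormalKernel L N (K ⊔ K') where
  le := sup_le h.le h'.le
  left_eq_zero z hz := by
    obtain ⟨y, hy, y', hy', rfl⟩ := Submodule.mem_sup.1 hz
    rw [map_add, h.left_eq_zero y hy, h'.left_eq_zero y' hy', add_zero]
  mem z hz x := by
    obtain ⟨y, hy, y', hy', rfl⟩ := Submodule.mem_sup.1 hz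
    rw [map_add]
    exact Submodule.add_mem_sup (h.mem y hy x) (h'.mem y' hy' x)
  adjoint_mem z hz x := by
    obtain ⟨y, hy, y', hy', rfl⟩ := Submodule.mem_sup.1 hz
    rw [map_add]
    exact Submodule.add_mem_sup (h.adjoint_mem y hy x) (h'.adjoint_mem y' hy' x)
  normal z hz x := by
    obtain ⟨y, hy, y', hy', rfl⟩ := Submodule.mem_sup.1 hz
    simp only [map_add, h.normal y hy x, h'.normal y' hy' x]

/-- Summing the second variation over a basis of `V` leaves `∑ (|(L x)* e|² - |L x e|²) = 0`. Summed
also over a basis of `E`, the left side is the total squared length of the components of `(L x)* e`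
orthogonal to `E`, so these all vanish. -/
lemma IsAntilinearFamily.adjoint_mem_of_common_kernel (h : IsAntilinearFamily J L)
    {N E : Submodule ℝ V} (hLN : ∀ x y, L x y ∈ N) (hq : ∀ x, quarticForm L x = 0) (hEN : E ≤ N)
    (hker : ∀ e ∈ E, ∀ n ∈ N, L n e = 0) (hE : ∀ e ∈ E, ∀ x, L x e ∈ E) :
    ∀ e ∈ E, ∀ x, adjointFamily L x e ∈ E := by
  set b := stdOrthonormalBasis ℝ V
  set c := stdOrthonormalBasis ℝ E
  have sv (e : V) (he : e ∈ E) (x : V) := h.second_variation hq (hker e he e (hEN he))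
    (fun x y => hker e he _ (hLN x y)) x
  have step1 : ∀ e ∈ E, ∑ i, (‖adjointFamily L (b i) e‖ ^ 2 - ‖L (b i) e‖ ^ 2) = 0 := by
    intro e he
    have h1 := Finset.sum_eq_zero fun i (_ : i ∈ Finset.univ) => sv e he (b i)
    have h2 := sum_norm_sq_adjoint b (L e)
    have h3 := sum_cross_terms b L e
    simp only [← adjointFamily_apply] at h2
    simp only [Finset.sum_add_distrib, Finset.sum_sub_distrib, ← Finset.mul_sum] at h1 ⊢
    linarith
  have step2 : ∀ x, ∑ j, (‖adjointFamily L x (c j)‖ ^ 2 - ‖L x (c j)‖ ^ 2) =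
      ∑ j, ‖adjointFamily L x (c j) - E.starProjection (adjointFamily L x (c j))‖ ^ 2 := by
    intro x
    rw [Finset.sum_sub_distrib, ← sum_norm_sq_adjoint_restrict c (L x) (fun e he => hE e he x),
      ← Finset.sum_sub_distrib]
    refine Finset.sum_congr rfl fun j _ => ?_
    have := Submodule.norm_sq_eq_add_norm_sq_starProjection (adjointFamily L x (c j)) E
    rw [Submodule.starProjection_orthogonal'] at this
    simp only [adjointFamily_apply] at this ⊢
    rw [this]
    simp
  have step3 : ∑ i, ∑ j, ‖adjointFamily L (b i) (c j) -
      E.starProjection (adjointFamily L (b i) (c j))‖ ^ 2 = 0 := by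
    simp only [← step2]
    rw [Finset.sum_comm]
    exact Finset.sum_eq_zero fun j _ => step1 _ (c j).2
  have step4 : ∀ i j, adjointFamily L (b i) (c j) ∈ E := by
    intro i j
    rw [Finset.sum_eq_zero_iff_of_nonneg (fun i _ => Finset.sum_nonneg fun j _ => sq_nonneg _)]
      at step3
    have h1 := step3 i (Finset.mem_univ _)
    rw [Finset.sum_eq_zero_iff_of_nonneg (fun j _ => sq_nonneg _)] at h1
    have h2 := h1 j (Finset.mem_univ _)
    rw [sq_eq_zero_iff, norm_eq_zero, sub_eq_zero] at h2
    rw [h2]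
    exact Submodule.starProjection_apply_mem _ _
  intro e he x
  have hx := b.sum_repr x
  have he' := congrArg (Subtype.val) (c.sum_repr ⟨e, he⟩)
  simp only [Submodule.coe_sum, Submodule.coe_smul] at he'
  rw [← hx, ← he']
  simp only [map_sum, map_smul, LinearMap.sum_apply, LinearMap.smul_apply]
  exact Submodule.sum_mem _ fun i _ => Submodule.smul_mem _ _
    (Submodule.sum_mem _ fun j _ => Submodule.smul_mem _ _ (step4 j i))

/-- Once `E` is stable under adjoints, the mixed terms of the second variation vanish and only four
squares remain. Summing over `E` compares `L e` with its adjoint on each vector and gives `L e = 0`;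
the remaining equality `|(L x)* e| = |L x e|` is normality on `E`. -/
lemma IsAntilinearFamily.isNormalKernel_of_common_kernel (h : IsAntilinearFamily J L)
    {N E : Submodule ℝ V} {F : ℕ → Submodule ℝ V} (hF : IsNilpotentFiltration L N F)
    (hLN : ∀ x y, L x y ∈ N) (hq : ∀ x, quarticForm L x = 0) (hEN : E ≤ N)
    (hker : ∀ e ∈ E, ∀ n ∈ N, L n e = 0) (hE : ∀ e ∈ E, ∀ x, L x e ∈ E) :
    IsNormalKernel L N E := by
  have hadj := h.adjoint_mem_of_common_kernel hLN hq hEN hker hE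
  have hadj0 : ∀ e ∈ E, ∀ n ∈ N, adjointFamily L n e = 0 := by
    intro e he n hn
    rw [← inner_self_eq_zero (𝕜 := ℝ), inner_adjointFamily_left, hker _ (hadj e he n) n hn,
      inner_zero_right]
  have sv : ∀ e ∈ E, ∀ x, ‖adjointFamily L e x‖ ^ 2 - ‖L e x‖ ^ 2 + ‖adjointFamily L x e‖ ^ 2
      - ‖L x e‖ ^ 2 = 0 := by
    intro e he x
    have h1 := h.second_variation hq (hker e he e (hEN he)) (fun x y => hker e he _ (hLN x y)) x
    rw [inner_adjointFamily_left, hker _ (hadj e he x) e (hEN he), ← inner_adjointFamily_right,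
      hadj0 e he _ (hLN e x)] at h1
    simpa using h1
  set c := stdOrthonormalBasis ℝ E
  have hsum : ∀ x, ∑ j, ‖adjointFamily L (c j : V) x‖ ^ 2 = ∑ j, ‖L (c j : V) x‖ ^ 2 := by
    intro x
    have h1 := Finset.sum_eq_zero fun j (_ : j ∈ Finset.univ) => sv (c j) (c j).2 x
    have h2 := sum_norm_sq_adjoint_restrict c (L x) (fun e he => hE e he x)
    have h3 : ∀ j, E.starProjection (LinearMap.adjoint (L x) (c j)) = adjointFamily L x (c j) :=
      fun j => Submodule.starProjection_eq_self_iff.2 (hadj _ (c j).2 x)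
    simp only [h3] at h2
    simp only [Finset.sum_add_distrib, Finset.sum_sub_distrib] at h1
    linarith
  -- Descending induction along the filtration: `L e x` lies one step deeper, where `(L e)*` already
  -- vanishes, so `|L e x|² = 0`; then `hsum` transfers the vanishing to the adjoints.
  have hdown : ∀ m k, F (k + m) = ⊥ → ∀ x ∈ F k, ∀ e ∈ E, L e x = 0 ∧ adjointFamily L e x = 0 := by
    intro m
    induction m with
    | zero =>
      intro k hk x hx e _
      rw [add_zero] at hk
      rw [hk, Submodule.mem_bot] at hx
      simp [hx]
    | succ m ih =>
      intro k hk x hx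
      have hL : ∀ e ∈ E, L e x = 0 := by
        intro e he
        have h1 := (ih (k + 1) (by rw [← hk]; congr 1; omega) _ (hF.shift k e (hEN he) x hx) e he).2
        rw [← inner_self_eq_zero (𝕜 := ℝ), ← inner_adjointFamily_right, h1, inner_zero_right]
      have hLs : ∀ j, adjointFamily L (c j : V) x = 0 := by
        have h1 := hsum x
        rw [Finset.sum_eq_zero (f := fun j => ‖L (c j : V) x‖ ^ 2)
          (fun j _ => by rw [hL _ (c j).2]; simp)] at h1
        rw [Finset.sum_eq_zero_iff_of_nonneg (fun j _ => sq_nonneg _)] at h1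
        intro j
        simpa using h1 j (Finset.mem_univ _)
      intro e he
      refine ⟨hL e he, ?_⟩
      have he' := congrArg (Subtype.val) (c.sum_repr ⟨e, he⟩)
      simp only [Submodule.coe_sum, Submodule.coe_smul] at he'
      rw [← he']
      simp only [map_sum, map_smul, LinearMap.sum_apply, LinearMap.smul_apply, hLs, smul_zero,
        Finset.sum_const_zero]
  have hzero : ∀ e ∈ E, L e = 0 := by
    obtain ⟨k, hk⟩ := hF.eventually_bot
    intro e he
    refine LinearMap.ext fun x => ?_
    have h1 := (hdown k 0 (by rwa [zero_add]) (L e x) (hF.le_zero (hLN e x)) e he).2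
    rw [LinearMap.zero_apply, ← inner_self_eq_zero (𝕜 := ℝ), ← inner_adjointFamily_right, h1,
      inner_zero_right]
  refine ⟨hEN, hzero, hE, hadj, fun e he x => ?_⟩
  have hnorm : ∀ e ∈ E, ⟪adjointFamily L x e, adjointFamily L x e⟫ = ⟪L x e, L x e⟫ := by
    intro e he
    have h1 := sv e he x
    simp only [adjointFamily_apply, hzero e he] at h1
    simp only [← adjointFamily_apply] at h1
    rw [real_inner_self_eq_norm_sq, real_inner_self_eq_norm_sq]
    simp at h1
    linarith
  have hpol : ∀ f ∈ E, ⟪adjointFamily L x e, adjointFamily L x f⟫ = ⟪L x e, L x f⟫ := by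
    intro f hf
    have h1 := hnorm (e + f) (E.add_mem he hf)
    have h2 := hnorm e he
    have h3 := hnorm f hf
    simp only [map_add, inner_add_left, inner_add_right] at h1
    rw [real_inner_comm (L x e) (L x f),
      real_inner_comm (adjointFamily L x e) (adjointFamily L x f)] at h1
    linarith
  have hort : ∀ f ∈ E, ⟪L x (adjointFamily L x e) - adjointFamily L x (L x e), f⟫ = 0 := by
    intro f hf
    rw [inner_sub_left, ← inner_adjointFamily_right, hpol f hf, inner_adjointFamily_left, sub_self]
  exact sub_eq_zero.1 (inner_self_eq_zero.1
    (hort _ (E.sub_mem (hE _ (hadj e he x) x) (hadj _ (hE e he x) x))))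

/-- The sign of `q` on `Nᗮ` and on the common kernel in `N` determines `k`. A maximal normal kernel
then equals `N`, as otherwise its complement in `N` would contain another one. On `Nᗮ` itself there
is nothing left, since `q = -|L x x|²` there. -/
theorem IsAntilinearFamily.normal_of_nilpotent (h : IsAntilinearFamily J L)
    {N : Submodule ℝ V} {F : ℕ → Submodule ℝ V} (hF : IsNilpotentFiltration L N F)
    (hN : N ≠ ⊤) (hJN : ∀ n ∈ N, J n ∈ N) (hLN : ∀ x y, L x y ∈ N)
    (hcomm : ∀ x y, ∃ n ∈ N, ∀ z, L x (L y z) - L y (L x z) = L n z)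
    {k : ℝ} (hq : ∀ x, quarticForm L x = k * ‖x‖ ^ 4) :
    k = 0 ∧ (∀ n ∈ N, L n = 0) ∧
      ∀ x z, L x (adjointFamily L x z) = adjointFamily L x (L x z) := by
  have hperp : ∀ x ∈ Nᗮ, ∀ y, adjointFamily L y x = 0 := by
    intro x hx y
    rw [← inner_self_eq_zero (𝕜 := ℝ), inner_adjointFamily_left, real_inner_comm]
    exact hx _ (hLN _ _)
  have hqperp : ∀ x ∈ Nᗮ, quarticForm L x = -‖L x x‖ ^ 2 := by
    intro x hx
    rw [quarticForm, hperp x hx, hx _ (hLN _ _)]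
    simp
  have hk : k = 0 := by
    have hNp : Nᗮ ≠ ⊥ := by rwa [Ne, Submodule.orthogonal_eq_bot_iff]
    obtain ⟨x, hx, hx0⟩ := Submodule.exists_mem_ne_zero_of_ne_bot hNp
    have hxn : 0 < ‖x‖ ^ 4 := by positivity
    have h1 : k ≤ 0 := by
      have h2 := hq x
      rw [hqperp x hx] at h2
      by_contra hcon
      have : 0 < k * ‖x‖ ^ 4 := mul_pos (not_le.1 hcon) hxn
      nlinarith [sq_nonneg ‖L x x‖]
    refine le_antisymm h1 ?_
    by_cases hNb : N = ⊥
    · have hL0 : L x x = 0 := by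
        have := hLN x x
        rwa [hNb, Submodule.mem_bot] at this
      have h2 := hq x
      rw [hqperp x hx, hL0, norm_zero] at h2
      by_contra hcon
      have : k * ‖x‖ ^ 4 < 0 := mul_neg_of_neg_of_pos (not_le.1 hcon) hxn
      linarith
    · obtain ⟨e, he, he0, hek⟩ := hF.exists_common_kernel hNb le_rfl (fun n _ w _ => hLN n w)
      have h2 := hq e
      have hen : 0 < ‖e‖ ^ 4 := by positivity
      rw [quarticForm, hek e he] at h2
      simp at h2
      by_contra hcon
      have : k * ‖e‖ ^ 4 < 0 := mul_neg_of_neg_of_pos (not_le.1 hcon) hen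
      nlinarith [sq_nonneg ‖adjointFamily L e e‖]
  subst hk
  refine ⟨rfl, ?_⟩
  simp only [zero_mul] at hq
  have hdiag : ∀ x ∈ Nᗮ, L x x = 0 := by
    intro x hx
    have := hqperp x hx
    rw [hq] at this
    simpa using this
  have hJperp : ∀ x ∈ Nᗮ, J x ∈ Nᗮ := by
    intro x hx n hn
    have := hx _ (hJN n hn)
    rw [h.inner_J_left] at this
    linarith
  -- Polarization makes `L` skew on `Nᗮ`. Linear in one argument and antilinear in the other, a skew
  -- form vanishes.
  have hperp0 : ∀ x ∈ Nᗮ, ∀ y ∈ Nᗮ, L x y = 0 := by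
    have hskew : ∀ x ∈ Nᗮ, ∀ y ∈ Nᗮ, L x y + L y x = 0 := by
      intro x hx y hy
      have := hdiag (x + y) (Nᗮ.add_mem hx hy)
      simp only [map_add, LinearMap.add_apply, hdiag x hx, hdiag y hy, zero_add, add_zero] at this
      rwa [add_comm]
    intro x hx y hy
    have h1 := hskew x hx y hy
    have h2 := congrArg J (hskew (J x) (hJperp x hx) y hy)
    rw [h.J_left, h.map_J, map_add, map_neg, h.J_J, h.J_J, neg_neg, map_zero] at h2
    have h3 : (2 : ℝ) • L x y = 0 := by
      rw [two_smul]
      have := congrArg₂ (· + ·) h1 h2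
      simp only [add_zero] at this
      rw [← this]; abel
    exact (smul_eq_zero.1 h3).resolve_left two_ne_zero
  obtain ⟨K, hK, hmax⟩ : ∃ K, IsNormalKernel L N K ∧
      ∀ K', IsNormalKernel L N K' → K ≤ K' → K' = K := by
    have hwf : WellFounded ((· > ·) : Submodule ℝ V → Submodule ℝ V → Prop) := wellFounded_gt
    obtain ⟨K, hK, hm⟩ := hwf.has_min {K | IsNormalKernel L N K} ⟨⊥, IsNormalKernel.bot L N⟩
    exact ⟨K, hK, fun K' hK' hle => (eq_of_le_of_not_lt hle (hm K' hK')).symm⟩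
  have hWbot : N ⊓ Kᗮ = ⊥ := by
    by_contra hW
    have hWinv : ∀ x, ∀ w ∈ N ⊓ Kᗮ, L x w ∈ N ⊓ Kᗮ := by
      intro x w hw
      refine ⟨hLN x w, fun z hz => ?_⟩
      rw [← inner_adjointFamily_left]
      exact hw.2 _ (hK.adjoint_mem z hz x)
    let E : Submodule ℝ V :=
      { carrier := {e | e ∈ N ⊓ Kᗮ ∧ ∀ n ∈ N, L n e = 0}
        add_mem' := fun ha hb => ⟨Submodule.add_mem _ ha.1 hb.1, fun n hn => by
          rw [map_add, ha.2 n hn, hb.2 n hn, add_zero]⟩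
        zero_mem' := ⟨Submodule.zero_mem _, fun n _ => map_zero _⟩
        smul_mem' := fun a e he => ⟨Submodule.smul_mem _ _ he.1, fun n hn => by
          rw [map_smul, he.2 n hn, smul_zero]⟩ }
    obtain ⟨e, he, he0, hek⟩ :=
      hF.exists_common_kernel hW inf_le_left (fun n _ w hw => hWinv n w hw)
    have hE : IsNormalKernel L N E := by
      refine h.isNormalKernel_of_common_kernel hF hLN hq (fun e he => he.1.1)
        (fun e he => he.2) (fun e he x => ⟨hWinv x e he.1, fun n hn => ?_⟩)
      -- The common kernel of the `L n` is stable under `L x` because commutators `[L n, L x]` are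
      -- again of the form `L m` with `m ∈ N`.
      obtain ⟨m, hm, hmz⟩ := hcomm n x
      have := hmz e
      rw [he.2 n hn, he.2 m hm, map_zero, sub_zero] at this
      exact this
    have heK : e ∈ K := by
      rw [← hmax _ (hK.sup hE) le_sup_left]
      exact Submodule.mem_sup_right ⟨he, hek⟩
    exact he0 (inner_self_eq_zero.1 (he.2 e heK))
  have hKN : K = N := by
    refine le_antisymm hK.le fun n hn => ?_
    have h1 : n - K.starProjection n ∈ N ⊓ Kᗮ :=
      ⟨N.sub_mem hn (hK.le (Submodule.starProjection_apply_mem _ _)),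
        Submodule.sub_starProjection_mem_orthogonal n⟩
    rw [hWbot, Submodule.mem_bot, sub_eq_zero] at h1
    rw [h1]
    exact Submodule.starProjection_apply_mem _ _
  subst hKN
  refine ⟨hK.left_eq_zero, fun x z => ?_⟩
  have hker : ∀ x, ∀ y ∈ Kᗮ, L x y = 0 := by
    intro x y hy
    have hx : x = K.starProjection x + (x - K.starProjection x) := by abel
    rw [hx, map_add, LinearMap.add_apply,
      hK.left_eq_zero _ (Submodule.starProjection_apply_mem _ _),
      hperp0 _ (Submodule.sub_starProjection_mem_orthogonal x) y hy]
    simp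
  have hz : z = K.starProjection z + (z - K.starProjection z) := by abel
  have hz' := Submodule.sub_starProjection_mem_orthogonal (K := K) z
  rw [hz]
  simp only [map_add, hperp _ hz', hker _ _ hz', add_zero]
  exact hK.normal _ (Submodule.starProjection_apply_mem _ _) x

end NilpotentFamily

/-! ## Algebraic Chern connection and curvature -/

section Chern

variable {V : Type*} [NormedAddCommGroup V] [InnerProductSpace ℝ V]

/-- `br` is a Lie bracket on the Euclidean space `V` and `J` an integrable orthogonal complex
structure. -/
structure IsHermitianBracket (J : V →ₗ[ℝ] V) (br : V →ₗ[ℝ] V →ₗ[ℝ] V) : Prop where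
  J_J : ∀ x, J (J x) = -x
  inner_J_J : ∀ x y, ⟪J x, J y⟫ = ⟪x, y⟫
  self : ∀ x, br x x = 0
  jacobi : ∀ x y z, br x (br y z) = br (br x y) z + br y (br x z)
  integrable : ∀ x y, br x y - br (J x) (J y) + J (br (J x) y) + J (br x (J y)) = 0

/-- The family `x ↦ (y ↦ [x, y] + J [J x, y])`, which represents the `(1,0)`-part of the bracket of
a `(0,1)`-vector and a `(1,0)`-vector. -/
noncomputable def bottFamily {V : Type*} [AddCommGroup V] [Module ℝ V] (J : V →ₗ[ℝ] V)
    (br : V →ₗ[ℝ] V →ₗ[ℝ] V) : V →ₗ[ℝ] V →ₗ[ℝ] V :=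
  LinearMap.mk₂ ℝ (fun x y => br x y + J (br (J x) y))
    (fun x x' y => by simp only [map_add, LinearMap.add_apply]; abel)
    (fun a x y => by simp only [map_smul, LinearMap.smul_apply, smul_add])
    (fun x y y' => by simp only [map_add]; abel)
    (fun a x y => by simp only [map_smul, smul_add])

lemma bottFamily_apply {V : Type*} [AddCommGroup V] [Module ℝ V] (J : V →ₗ[ℝ] V)
    (br : V →ₗ[ℝ] V →ₗ[ℝ] V) (x y : V) :
    bottFamily J br x y = br x y + J (br (J x) y) := rfl

namespace IsHermitianBracket

variable {J : V →ₗ[ℝ] V} {br : V →ₗ[ℝ] V →ₗ[ℝ] V}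

lemma swap (h : IsHermitianBracket J br) (x y : V) : br x y = -br y x := by
  have := h.self (x + y)
  simp only [map_add, LinearMap.add_apply, h.self, zero_add, add_zero] at this
  exact eq_neg_of_add_eq_zero_right this

lemma isAntilinearFamily (h : IsHermitianBracket J br) :
    IsAntilinearFamily J (bottFamily J br) where
  J_J := h.J_J
  inner_J_J := h.inner_J_J
  map_J x y := by
    have := congrArg J (h.integrable x y)
    simp only [map_add, map_sub, h.J_J, map_zero] at this
    simp only [bottFamily_apply, map_add, h.J_J]
    rw [← sub_eq_zero, ← neg_eq_zero, ← this]
    abel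
  J_left x y := by
    simp only [bottFamily_apply, map_add, h.J_J, map_neg, LinearMap.neg_apply]
    abel

lemma bottFamily_self (h : IsHermitianBracket J br) (x : V) :
    bottFamily J br x x = -J (br x (J x)) := by
  rw [bottFamily_apply, h.self, h.swap (J x) x, map_neg, zero_add]

/-- This is the Jacobi identity for two `(0,1)`-vectors and a `(1,0)`-vector: the bracket modulo
`(0,1)`-vectors is a flat partial connection. Integrability enters through `hp`. -/
lemma bottFamily_comm (h : IsHermitianBracket J br) (x y z : V) :
    bottFamily J br x (bottFamily J br y z) - bottFamily J br y (bottFamily J br x z) =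
      bottFamily J br (br x y - br (J x) (J y)) z := by
  have hp : J (br x y - br (J x) (J y)) = br (J x) y + br x (J y) := by
    have := congrArg J (h.integrable x y)
    simp only [map_add, map_sub, h.J_J, map_zero] at this
    rw [map_sub, ← sub_eq_zero, ← this]; abel
  have e : ∀ x y z, bottFamily J br x (bottFamily J br y z) =
      br x (br y z) + J (br (J x) (br y z)) + J (br x (br (J y) z)) - br (J x) (br (J y) z) := by
    intro x y z
    conv_lhs => rw [bottFamily_apply J br y z, map_add, h.isAntilinearFamily.map_J,
      bottFamily_apply, bottFamily_apply]
    simp only [map_add, h.J_J]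
    abel
  rw [e, e, bottFamily_apply, hp]
  rw [h.jacobi x y z, h.jacobi (J x) y z, h.jacobi x (J y) z, h.jacobi (J x) (J y) z]
  simp only [map_add, map_sub, LinearMap.add_apply, LinearMap.sub_apply]
  abel

end IsHermitianBracket

variable [FiniteDimensional ℝ V]

/-- The Chern connection on left-invariant vector fields. -/
noncomputable def chernFamily (J : V →ₗ[ℝ] V) (br : V →ₗ[ℝ] V →ₗ[ℝ] V) : V →ₗ[ℝ] V →ₗ[ℝ] V :=
  (1 / 2 : ℝ) • (bottFamily J br - adjointFamily (bottFamily J br))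

lemma chernFamily_apply (J : V →ₗ[ℝ] V) (br : V →ₗ[ℝ] V →ₗ[ℝ] V) (x y : V) :
    chernFamily J br x y =
      (1 / 2 : ℝ) • (bottFamily J br x y - adjointFamily (bottFamily J br) x y) := rfl

/-- The curvature operator of the Chern connection on left-invariant vector fields. -/
noncomputable def chernCurvature (J : V →ₗ[ℝ] V) (br : V →ₗ[ℝ] V →ₗ[ℝ] V) (x y : V) :
    V →ₗ[ℝ] V :=
  chernFamily J br x ∘ₗ chernFamily J br y - chernFamily J br y ∘ₗ chernFamily J br x -
    chernFamily J br (br x y)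

lemma chernCurvature_apply (J : V →ₗ[ℝ] V) (br : V →ₗ[ℝ] V →ₗ[ℝ] V) (x y z : V) :
    chernCurvature J br x y z = chernFamily J br x (chernFamily J br y z) -
      chernFamily J br y (chernFamily J br x z) - chernFamily J br (br x y) z := rfl

namespace IsHermitianBracket

variable {J : V →ₗ[ℝ] V} {br : V →ₗ[ℝ] V →ₗ[ℝ] V}

/-- Since `L` kills brackets, the `L x` commute, and so do their adjoints; polarized normality makes
each `L x` commute with each `(L y)*`. The connection operators therefore commute, and the one
attached to `[x, y]` is zero. -/
lemma chernCurvature_eq_zero (h : IsHermitianBracket J br)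
    (hbr : ∀ x y, bottFamily J br (br x y) = 0)
    (hn : ∀ x z, bottFamily J br x (adjointFamily (bottFamily J br) x z) =
      adjointFamily (bottFamily J br) x (bottFamily J br x z)) (x y : V) :
    chernCurvature J br x y = 0 := by
  set L := bottFamily J br with hL
  have hc := h.isAntilinearFamily.commute_adjoint_of_normal hn
  rw [← hL] at hc
  have h1 : ∀ x y z, L x (L y z) = L y (L x z) := by
    intro x y z
    have := h.bottFamily_comm x y z
    rw [map_sub, hbr, hbr, sub_zero, LinearMap.zero_apply] at this
    exact sub_eq_zero.1 this
  have h2 : ∀ z, adjointFamily L x (adjointFamily L y z) =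
      adjointFamily L y (adjointFamily L x z) := by
    intro z
    refine ext_inner_right ℝ fun w => ?_
    simp only [inner_adjointFamily_left]
    rw [h1]
  have h3 : ∀ z, adjointFamily L (br x y) z = 0 := by
    intro z
    rw [adjointFamily_apply, hbr]; simp
  refine LinearMap.ext fun z => ?_
  simp only [chernCurvature_apply, chernFamily_apply, map_smul, map_sub, ← hL, h3, hbr,
    LinearMap.zero_apply]
  rw [h1 x y, h2, hc x y, hc y x]
  module

/-- By antilinearity `∇_{J x}` is `-J (L x + (L x)*) / 2`, so the commutator with `∇_x` reduces to
`[L x, (L x)*]`; the remaining terms come from `[x, J x] = J (L x x)`. -/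
lemma J_chernCurvature (h : IsHermitianBracket J br) (x y : V) :
    J (chernCurvature J br x (J x) y) = (1 / 2 : ℝ) •
      (bottFamily J br x (adjointFamily (bottFamily J br) x y) -
        adjointFamily (bottFamily J br) x (bottFamily J br x y) -
        bottFamily J br (bottFamily J br x x) y -
        adjointFamily (bottFamily J br) (bottFamily J br x x) y) := by
  have hA := h.isAntilinearFamily
  have hz : br x (J x) = J (bottFamily J br x x) := by
    rw [h.bottFamily_self, map_neg, h.J_J, neg_neg]
  set L := bottFamily J br with hL
  simp only [chernCurvature_apply, chernFamily_apply, map_smul, map_sub, ← hL, hz, hA.J_left,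
    hA.adjoint_J_left, hA.adjoint_map_J, hA.map_J, map_neg, h.J_J, neg_neg]
  module

lemma inner_chernCurvature_self (h : IsHermitianBracket J br) (x : V) :
    -4 * ⟪chernCurvature J br x (J x) x, J x⟫ = 2 * quarticForm (bottFamily J br) x := by
  have h1 : ⟪chernCurvature J br x (J x) x, J x⟫ = -⟪J (chernCurvature J br x (J x) x), x⟫ := by
    rw [h.isAntilinearFamily.inner_J_left]; ring
  rw [h1, h.J_chernCurvature, quarticForm, real_inner_smul_left, inner_sub_left, inner_sub_left,
    inner_sub_left, ← inner_adjointFamily_right, real_inner_self_eq_norm_sq,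
    inner_adjointFamily_left, real_inner_self_eq_norm_sq, inner_adjointFamily_left,
    real_inner_comm _ x]
  ring

/-- The commutator in `J_chernCurvature` has no trace, and an operator has the same trace as its
adjoint. -/
lemma trace_J_chernCurvature (h : IsHermitianBracket J br) (x : V) :
    LinearMap.trace ℝ V (J ∘ₗ chernCurvature J br x (J x)) =
      -LinearMap.trace ℝ V (bottFamily J br (bottFamily J br x x)) := by
  set L := bottFamily J br with hL
  have h1 : J ∘ₗ chernCurvature J br x (J x) = (1 / 2 : ℝ) •
      (L x * adjointFamily L x - adjointFamily L x * L x - L (L x x) - adjointFamily L (L x x)) :=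
    LinearMap.ext fun y => h.J_chernCurvature x y
  have h2 : LinearMap.trace ℝ V (adjointFamily L (L x x)) = LinearMap.trace ℝ V (L (L x x)) := by
    rw [LinearMap.trace_eq_sum_inner _ (stdOrthonormalBasis ℝ V),
      LinearMap.trace_eq_sum_inner _ (stdOrthonormalBasis ℝ V)]
    refine Finset.sum_congr rfl fun i _ => ?_
    rw [inner_adjointFamily_right, real_inner_comm]
  rw [h1, map_smul, map_sub, map_sub, map_sub, LinearMap.trace_mul_comm, h2]
  simp only [smul_eq_mul]
  ring

end IsHermitianBracket

end Chern

/-! ## Unitary frames and the mixed curvature -/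

section Frames

variable {V : Type*} [NormedAddCommGroup V] [InnerProductSpace ℝ V] [FiniteDimensional ℝ V]
  {J : V →ₗ[ℝ] V} {br : V →ₗ[ℝ] V →ₗ[ℝ] V}

lemma exists_orthonormal_complex_frame (hJJ : ∀ x, J (J x) = -x)
    (hJ : ∀ x y, ⟪J x, J y⟫ = ⟪x, y⟫) (k : ℕ) (hk : 2 * k ≤ Module.finrank ℝ V) :
    ∃ f : Fin k → V, (∀ i j, ⟪f i, f j⟫ = if i = j then 1 else 0) ∧ ∀ i j, ⟪f i, J (f j)⟫ = 0 := by
  have hJl : ∀ x y, ⟪J x, y⟫ = -⟪x, J y⟫ := by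
    intro x y
    have := hJ x (J y)
    rw [hJJ, inner_neg_right] at this
    linarith
  have hself : ∀ x, ⟪x, J x⟫ = 0 := by
    intro x
    have := hJl x x
    rw [real_inner_comm] at this
    linarith
  induction k with
  | zero => exact ⟨Fin.elim0, fun i => i.elim0, fun i => i.elim0⟩
  | succ k ih =>
    obtain ⟨f, hf, hfJ⟩ := ih (by omega)
    set S := Submodule.span ℝ (Set.range (Sum.elim f (J ∘ f)))
    have hS : Sᗮ ≠ ⊥ := by
      rw [Ne, Submodule.orthogonal_eq_bot_iff]
      intro htop
      have h1 := finrank_range_le_card (R := ℝ) (Sum.elim f (J ∘ f))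
      rw [Set.finrank] at h1
      change Module.finrank ℝ S ≤ _ at h1
      rw [htop, finrank_top] at h1
      simp at h1
      omega
    obtain ⟨g, hg, hg0⟩ := Submodule.exists_mem_ne_zero_of_ne_bot hS
    have hgf : ∀ i, ⟪f i, g⟫ = 0 := fun i => hg _ (Submodule.subset_span ⟨Sum.inl i, rfl⟩)
    have hgJ : ∀ i, ⟪J (f i), g⟫ = 0 := fun i => hg _ (Submodule.subset_span ⟨Sum.inr i, rfl⟩)
    set u := (‖g‖⁻¹ : ℝ) • g with hu
    have huu : ⟪u, u⟫ = 1 := by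
      rw [hu, real_inner_smul_left, real_inner_smul_right, real_inner_self_eq_norm_sq]
      have : ‖g‖ ≠ 0 := norm_ne_zero_iff.2 hg0
      field_simp
    have huf : ∀ i, ⟪f i, u⟫ = 0 := fun i => by rw [hu, real_inner_smul_right, hgf, mul_zero]
    have huJ : ∀ i, ⟪J (f i), u⟫ = 0 := fun i => by rw [hu, real_inner_smul_right, hgJ, mul_zero]
    refine ⟨Fin.snoc f u, fun i j => ?_, fun i j => ?_⟩
    · refine Fin.lastCases ?_ (fun i => ?_) i <;> refine Fin.lastCases ?_ (fun j => ?_) j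
      · simp only [Fin.snoc_last, if_true, huu]
      · simp only [Fin.snoc_last, Fin.snoc_castSucc]
        rw [real_inner_comm, huf, if_neg (Fin.castSucc_lt_last j).ne']
      · simp only [Fin.snoc_last, Fin.snoc_castSucc]
        rw [huf, if_neg (Fin.castSucc_lt_last i).ne]
      · simp only [Fin.snoc_castSucc, hf, Fin.castSucc_inj]
    · refine Fin.lastCases ?_ (fun i => ?_) i <;> refine Fin.lastCases ?_ (fun j => ?_) j
      · simp only [Fin.snoc_last]
        exact hself u
      · simp only [Fin.snoc_last, Fin.snoc_castSucc]
        rw [real_inner_comm, huJ]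
      · simp only [Fin.snoc_last, Fin.snoc_castSucc]
        have := huJ i
        rw [hJl] at this
        linarith
      · simp only [Fin.snoc_castSucc, hfJ]

/-- The real vectors `u i` for which the `u i - √-1 J (u i)` form a unitary frame. -/
def IsRealUnitaryFrame (J : V →ₗ[ℝ] V) {n : ℕ} (u : Fin n → V) : Prop :=
  (∀ i j, ⟪u i, u j⟫ = if i = j then 1 / 2 else 0) ∧ ∀ i j, ⟪u i, J (u j)⟫ = 0

lemma exists_isRealUnitaryFrame (hJJ : ∀ x, J (J x) = -x) (hJ : ∀ x y, ⟪J x, J y⟫ = ⟪x, y⟫)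
    {n : ℕ} (hn : Module.finrank ℝ V = 2 * n) : ∃ u : Fin n → V, IsRealUnitaryFrame J u := by
  obtain ⟨f, hf, hfJ⟩ := exists_orthonormal_complex_frame hJJ hJ n hn.ge
  refine ⟨fun i => (√2)⁻¹ • f i, fun i j => ?_, fun i j => ?_⟩
  · rw [real_inner_smul_left, real_inner_smul_right, hf, ← mul_assoc, ← mul_inv,
      Real.mul_self_sqrt zero_le_two]
    split_ifs <;> norm_num
  · rw [map_smul, real_inner_smul_left, real_inner_smul_right, hfJ]
    simp

namespace IsHermitianBracket

lemma chernFamily_map_J (h : IsHermitianBracket J br) (x y : V) :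
    chernFamily J br x (J y) = J (chernFamily J br x y) := by
  rw [chernFamily_apply, chernFamily_apply, h.isAntilinearFamily.map_J,
    h.isAntilinearFamily.adjoint_map_J, map_smul, map_sub]

lemma chernCurvature_map_J (h : IsHermitianBracket J br) (x y z : V) :
    chernCurvature J br x y (J z) = J (chernCurvature J br x y z) := by
  simp only [chernCurvature_apply, h.chernFamily_map_J, map_sub]

/-- The vectors `√2 u i`, `√2 J (u i)` form an orthonormal basis, in which the Ricci sum is the real
trace of `J R(x, J x)`. -/
lemma sum_inner_chernCurvature (h : IsHermitianBracket J br) {n : ℕ} (hn0 : 0 < n)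
    (hn : Module.finrank ℝ V = 2 * n) {u : Fin n → V} (hu : IsRealUnitaryFrame J u) (x : V) :
    -4 * ∑ i, ⟪chernCurvature J br x (J x) (u i), J (u i)⟫ =
      -LinearMap.trace ℝ V (bottFamily J br (bottFamily J br x x)) := by
  have hJl := h.isAntilinearFamily.inner_J_left
  have hon : Orthonormal ℝ (Sum.elim (fun i => √2 • u i) (fun i => √2 • J (u i))) := by
    rw [orthonormal_iff_ite]
    rintro (i | i) (j | j) <;>
      simp only [Sum.elim_inl, Sum.elim_inr, real_inner_smul_left, real_inner_smul_right,
        ← mul_assoc,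
        Real.mul_self_sqrt zero_le_two, Sum.inl.injEq, Sum.inr.injEq, h.inner_J_J, hu.1, hu.2, hJl]
    · split_ifs <;> norm_num
    · simp
    · simp
    · split_ifs <;> norm_num
  have : Nonempty (Fin n ⊕ Fin n) := ⟨Sum.inl ⟨0, hn0⟩⟩
  let b := (basisOfOrthonormalOfCardEqFinrank hon (by simp [hn]; ring)).toOrthonormalBasis
    (by simpa using hon)
  rw [← h.trace_J_chernCurvature, LinearMap.trace_eq_sum_inner _ b, Fintype.sum_sum_type,
    ← Finset.sum_add_distrib, Finset.mul_sum]
  refine Finset.sum_congr rfl fun i _ => ?_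
  simp only [b, Module.Basis.coe_toOrthonormalBasis, coe_basisOfOrthonormalOfCardEqFinrank,
    Sum.elim_inl,
    Sum.elim_inr, LinearMap.comp_apply, map_smul, real_inner_smul_left, real_inner_smul_right,
    ← mul_assoc, Real.mul_self_sqrt zero_le_two, h.chernCurvature_map_J, h.inner_J_J]
  rw [real_inner_comm _ (u i), hJl]
  ring

lemma mixedCurvature_homogeneous (h : IsHermitianBracket J br) {n : ℕ} (hn0 : 0 < n)
    (hn : Module.finrank ℝ V = 2 * n) {α β c : ℝ}
    (hc : ∀ u : Fin n → V, IsRealUnitaryFrame J u → ∀ x : V, ⟪x, x⟫ = 1 / 2 →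
      α * (-4 * ∑ i, ⟪chernCurvature J br x (J x) (u i), J (u i)⟫) +
        β * (-4 * ⟪chernCurvature J br x (J x) x, J x⟫) = c) (x : V) :
    α * (-LinearMap.trace ℝ V (bottFamily J br (bottFamily J br x x))) * ‖x‖ ^ 2 +
      β * quarticForm (bottFamily J br) x = 2 * c * ‖x‖ ^ 4 := by
  obtain ⟨u, hu⟩ := exists_isRealUnitaryFrame h.J_J h.inner_J_J hn
  by_cases hx : x = 0
  · simp [hx, quarticForm]
  have hx' : ‖x‖ ≠ 0 := norm_ne_zero_iff.2 hx
  -- The `(1,0)`-vector `x - √-1 J x` has squared length `2 |x|²`, so a unit vector corresponds to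
  -- `|x|² = 1 / 2`.
  set t : ℝ := (√2)⁻¹ * ‖x‖⁻¹ with ht
  have ht2 : t ^ 2 * ‖x‖ ^ 2 = 1 / 2 := by
    rw [ht, mul_pow, inv_pow, inv_pow, Real.sq_sqrt zero_le_two]
    field_simp
  have h1 := hc u hu (t • x) (by
    rw [real_inner_smul_left, real_inner_smul_right, real_inner_self_eq_norm_sq, ← ht2]; ring)
  rw [h.sum_inner_chernCurvature hn0 hn hu, h.inner_chernCurvature_self] at h1
  simp only [quarticForm, map_smul, LinearMap.smul_apply, norm_smul, real_inner_smul_left,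
    real_inner_smul_right, smul_eq_mul, mul_pow, Real.norm_eq_abs, sq_abs] at h1 ⊢
  have h2 : t ^ 4 * ‖x‖ ^ 4 = 1 / 4 := by
    rw [show t ^ 4 * ‖x‖ ^ 4 = (t ^ 2 * ‖x‖ ^ 2) ^ 2 by ring, ht2]; norm_num
  set τ := LinearMap.trace ℝ V (bottFamily J br (bottFamily J br x x))
  set a := ‖adjointFamily (bottFamily J br) x x‖
  set b := ‖bottFamily J br x x‖
  set d := ⟪bottFamily J br (bottFamily J br x x) x, x⟫
  linear_combination (2 * ‖x‖ ^ 4) * h1 + (2 * α * τ * ‖x‖ ^ 2) * ht2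
    - (4 * β * (a ^ 2 - b ^ 2 - 2 * d)) * h2

end IsHermitianBracket

end Frames

/-! ## Families with an abelian complex subspace of codimension two -/

section CodimTwo

variable {V : Type*} [NormedAddCommGroup V] [InnerProductSpace ℝ V]

/-- The unit vector `e` spans with `J e` the orthogonal of the complex subspace `𝔞`, and the family
`L` vanishes on `𝔞 × 𝔞`, has values in `𝔞` on `V × 𝔞` and `𝔞 × V`, and `L e e = b e + v`. -/
structure IsCodimTwoFamily (J : V →ₗ[ℝ] V) (L : V →ₗ[ℝ] V →ₗ[ℝ] V) (𝔞 : Submodule ℝ V)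
    (e : V) (b : ℝ) (v : V) : Prop extends IsAntilinearFamily J L where
  J_mem : ∀ w ∈ 𝔞, J w ∈ 𝔞
  inner_e_e : ⟪e, e⟫ = 1
  inner_mem_e : ∀ w ∈ 𝔞, ⟪w, e⟫ = 0
  sub_mem : ∀ x, x - ⟪x, e⟫ • e - ⟪x, J e⟫ • J e ∈ 𝔞
  left_eq_zero : ∀ w ∈ 𝔞, ∀ u ∈ 𝔞, L w u = 0
  e_left_mem : ∀ w ∈ 𝔞, L e w ∈ 𝔞
  e_right_mem : ∀ w ∈ 𝔞, L w e ∈ 𝔞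
  e_e : L e e = b • e + v
  v_mem : v ∈ 𝔞

variable {J : V →ₗ[ℝ] V} {L : V →ₗ[ℝ] V →ₗ[ℝ] V} {𝔞 : Submodule ℝ V}
  {e : V} {b : ℝ} {v : V}

namespace IsCodimTwoFamily

lemma inner_mem_Je (h : IsCodimTwoFamily J L 𝔞 e b v) {w : V} (hw : w ∈ 𝔞) : ⟪w, J e⟫ = 0 := by
  have h1 := h.inner_mem_e _ (h.J_mem w hw)
  rw [h.inner_J_left] at h1
  linarith

lemma inner_e_Je (h : IsCodimTwoFamily J L 𝔞 e b v) : ⟪e, J e⟫ = 0 := by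
  have h1 := h.inner_J_left e e
  rw [real_inner_comm] at h1
  linarith

lemma left_self (h : IsCodimTwoFamily J L 𝔞 e b v) {w : V} (hw : w ∈ 𝔞) (s : ℝ) :
    L (e + s • w) (e + s • w) = b • e + (v + s • (L e w + L w e)) := by
  simp only [map_add, map_smul, LinearMap.add_apply, LinearMap.smul_apply, h.left_eq_zero w hw w hw,
    h.e_e, smul_add, smul_zero, add_zero]
  abel

variable [FiniteDimensional ℝ V]

lemma starProjection_eq (h : IsCodimTwoFamily J L 𝔞 e b v) (x : V) :
    𝔞.starProjection x = x - ⟪x, e⟫ • e - ⟪x, J e⟫ • J e := by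
  refine Submodule.eq_starProjection_of_mem_of_inner_eq_zero (h.sub_mem x) fun w hw => ?_
  rw [show x - (x - ⟪x, e⟫ • e - ⟪x, J e⟫ • J e) = ⟪x, e⟫ • e + ⟪x, J e⟫ • J e by abel,
    inner_add_left, real_inner_smul_left, real_inner_smul_left, real_inner_comm w e,
    h.inner_mem_e w hw,
    real_inner_comm w (J e), h.inner_mem_Je hw]
  ring

lemma norm_sq_eq (h : IsCodimTwoFamily J L 𝔞 e b v) (x : V) :
    ‖x‖ ^ 2 = ⟪x, e⟫ ^ 2 + ⟪x, J e⟫ ^ 2 + ‖𝔞.starProjection x‖ ^ 2 := by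
  have hx : x = 𝔞.starProjection x + ⟪x, e⟫ • e + ⟪x, J e⟫ • J e := by
    rw [h.starProjection_eq]; abel
  have hp := Submodule.starProjection_apply_mem 𝔞 x
  have h1 := h.inner_mem_e _ hp
  have h2 := h.inner_mem_Je hp
  have h3 := h.inner_e_Je
  have h4 := h.inner_e_e
  have h5 : ⟪J e, J e⟫ = 1 := by rw [h.inner_J_J, h4]
  generalize 𝔞.starProjection x = p at *
  generalize ⟪x, e⟫ = s at *
  generalize ⟪x, J e⟫ = t at *
  rw [hx, ← real_inner_self_eq_norm_sq, ← real_inner_self_eq_norm_sq]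
  simp only [inner_add_left, inner_add_right, real_inner_smul_left, real_inner_smul_right,
    h1, h2, h3, h4, h5, real_inner_comm p, real_inner_comm e (J e)]
  ring

lemma trace_eq (h : IsCodimTwoFamily J L 𝔞 e b v) {ι : Type*} [Fintype ι]
    (c : OrthonormalBasis ι ℝ 𝔞) (f : V →ₗ[ℝ] V) :
    LinearMap.trace ℝ V f = ∑ j, ⟪(c j : V), f (c j)⟫ + ⟪e, f e⟫ + ⟪J e, f (J e)⟫ := by
  let π : V →ₗ[ℝ] 𝔞 := (𝔞.orthogonalProjectionOnto : V →L[ℝ] 𝔞).toLinearMap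
  have hf : f = (f ∘ₗ 𝔞.subtype) ∘ₗ π + ((innerₛₗ ℝ e).smulRight (f e) +
      (innerₛₗ ℝ (J e)).smulRight (f (J e))) := by
    refine LinearMap.ext fun x => ?_
    have hx : x = 𝔞.starProjection x + (⟪e, x⟫ • e + ⟪J e, x⟫ • J e) := by
      rw [h.starProjection_eq, real_inner_comm e, real_inner_comm (J e)]; abel
    conv_lhs => rw [hx]
    simp [π]
  have h1 : LinearMap.trace ℝ V ((f ∘ₗ 𝔞.subtype) ∘ₗ π) = ∑ j, ⟪(c j : V), f (c j)⟫ := by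
    rw [LinearMap.trace_comp_comm', LinearMap.trace_eq_sum_inner _ c]
    refine Finset.sum_congr rfl fun j _ => ?_
    simp only [LinearMap.comp_apply, Submodule.coe_inner, Submodule.subtype_apply, π]
    change ⟪(c j : V), 𝔞.starProjection (f (c j))⟫ = _
    rw [← Submodule.inner_starProjection_left_eq_right,
      Submodule.starProjection_eq_self_iff.2 (c j).2]
  conv_lhs => rw [hf]
  rw [map_add, map_add, h1, LinearMap.trace_smulRight, LinearMap.trace_smulRight]
  simp only [innerₛₗ_apply_apply]
  ring

/-- Only the component along `e` contributes: for `y ∈ 𝔞` the operator `L y` kills `𝔞` and sends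
`e`, `J e` into `𝔞`. Thus the Ricci term is constant along `e + s w`. -/
lemma trace_left (h : IsCodimTwoFamily J L 𝔞 e b v) {ι : Type*} [Fintype ι]
    (c : OrthonormalBasis ι ℝ 𝔞) {y : V} (hy : y ∈ 𝔞) :
    LinearMap.trace ℝ V (L (b • e + y)) = b * (2 * b + ∑ j, ⟪(c j : V), L e (c j)⟫) := by
  have h1 : LinearMap.trace ℝ V (L y) = 0 := by
    rw [h.trace_eq c, h.map_J, h.inner_J_J, real_inner_comm, h.inner_mem_e _ (h.e_right_mem y hy)]
    simp only [add_zero]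
    exact Finset.sum_eq_zero fun j _ => by rw [h.left_eq_zero y hy _ (c j).2, inner_zero_right]
  have h2 : ⟪e, L e e⟫ = b := by
    rw [h.e_e, inner_add_right, real_inner_smul_right, h.inner_e_e, real_inner_comm,
      h.inner_mem_e v h.v_mem]
    ring
  rw [map_add, map_add, map_smul, map_smul, h1, h.trace_eq c, h.map_J, h.inner_J_J, h2, smul_eq_mul]
  ring

lemma quarticForm_eq (h : IsCodimTwoFamily J L 𝔞 e b v) {w : V} (hw : w ∈ 𝔞) (s : ℝ) :
    quarticForm L (e + s • w) =
      (b + s * ⟪w, v⟫ + s ^ 2 * ⟪w, L w e⟫) ^ 2 + (s * ⟪w, J v⟫ + s ^ 2 * ⟪w, J (L w e)⟫) ^ 2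
      + s ^ 2 * ‖𝔞.starProjection (adjointFamily L e w)‖ ^ 2
      - (b ^ 2 + ‖v + s • (L e w + L w e)‖ ^ 2)
      - 2 * (b ^ 2 + s * ⟪b • v + L v e, w⟫
        + s ^ 2 * ⟪b • L e w + L (L e w) e + L (L w e) e, w⟫) := by
  have hAw := h.e_left_mem w hw
  have hTw := h.e_right_mem w hw
  have h1 : ∀ u ∈ 𝔞, ⟪e, u⟫ = 0 := fun u hu => by rw [real_inner_comm, h.inner_mem_e u hu]
  have hJe : ⟪e, J e⟫ = 0 := h.inner_e_Je
  have hadj : ‖adjointFamily L (e + s • w) (e + s • w)‖ ^ 2 =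
      (b + s * ⟪w, v⟫ + s ^ 2 * ⟪w, L w e⟫) ^ 2 + (s * ⟪w, J v⟫ + s ^ 2 * ⟪w, J (L w e)⟫) ^ 2
      + s ^ 2 * ‖𝔞.starProjection (adjointFamily L e w)‖ ^ 2 := by
    rw [h.norm_sq_eq]
    congr 1
    · congr 2
      · rw [inner_adjointFamily_left]
        simp only [map_add, map_smul, LinearMap.add_apply, LinearMap.smul_apply, h.e_e,
          inner_add_left, inner_add_right, real_inner_smul_left, real_inner_smul_right, h.inner_e_e,
          h1 _ h.v_mem, h1 _ hTw, h.inner_mem_e w hw]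
        ring
      · rw [inner_adjointFamily_left, h.map_J]
        simp only [map_add, map_smul, LinearMap.add_apply, LinearMap.smul_apply, h.e_e,
          inner_add_left, inner_add_right, real_inner_smul_left, real_inner_smul_right, hJe,
          h1 _ (h.J_mem _ h.v_mem), h1 _ (h.J_mem _ hTw), h.inner_mem_Je hw]
        ring
    · have : 𝔞.starProjection (adjointFamily L (e + s • w) (e + s • w)) =
          s • 𝔞.starProjection (adjointFamily L e w) := by
        symm
        rw [← map_smul]
        refine Submodule.eq_starProjection_of_mem_of_inner_eq_zero
          (Submodule.starProjection_apply_mem _ _) fun u hu => ?_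
        rw [inner_sub_left, Submodule.inner_starProjection_left_eq_right,
          Submodule.starProjection_eq_self_iff.2 hu, inner_adjointFamily_left, real_inner_smul_left,
          inner_adjointFamily_left]
        simp only [map_add, map_smul, LinearMap.add_apply, LinearMap.smul_apply, inner_add_left,
          inner_add_right, real_inner_smul_left, real_inner_smul_right, h.left_eq_zero w hw u hu,
          h1 _ (h.e_left_mem u hu), inner_zero_right]
        ring
      rw [this, norm_smul, mul_pow, Real.norm_eq_abs, sq_abs]
  have hy : v + s • (L e w + L w e) ∈ 𝔞 :=
    𝔞.add_mem h.v_mem (𝔞.smul_mem _ (𝔞.add_mem hAw hTw))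
  have hself : ‖L (e + s • w) (e + s • w)‖ ^ 2 = b ^ 2 + ‖v + s • (L e w + L w e)‖ ^ 2 := by
    rw [h.left_self hw]
    generalize v + s • (L e w + L w e) = y at *
    rw [← real_inner_self_eq_norm_sq, ← real_inner_self_eq_norm_sq, inner_add_left, inner_add_right,
      inner_add_right, real_inner_smul_left, real_inner_smul_left, real_inner_smul_right,
      real_inner_smul_right, h.inner_e_e, h.inner_mem_e y hy, h1 y hy]
    ring
  have hcubic : ⟪L (L (e + s • w) (e + s • w)) (e + s • w), e + s • w⟫ =
      b ^ 2 + s * ⟪b • v + L v e, w⟫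
        + s ^ 2 * ⟪b • L e w + L (L e w) e + L (L w e) e, w⟫ := by
    rw [h.left_self hw]
    simp only [map_add, map_smul, LinearMap.add_apply, LinearMap.smul_apply, h.e_e,
      h.left_eq_zero v h.v_mem w hw, h.left_eq_zero _ hAw w hw, h.left_eq_zero _ hTw w hw,
      inner_add_left, inner_add_right, real_inner_smul_left, real_inner_smul_right, h.inner_e_e,
      h.inner_mem_e _ h.v_mem, h.inner_mem_e _ (h.e_right_mem _ h.v_mem),
      h.inner_mem_e _ (h.e_right_mem _ hAw), h.inner_mem_e _ (h.e_right_mem _ hTw),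
      h.inner_mem_e _ hAw, h1 w hw, smul_zero, smul_add, inner_zero_left]
    ring
  rw [quarticForm, hadj, hself, hcubic]

end IsCodimTwoFamily

end CodimTwo

/-! ### Coefficients of the mixed curvature identity in codimension two -/

section CodimTwoMixed

variable {V : Type*} [NormedAddCommGroup V] [InnerProductSpace ℝ V]
  {J : V →ₗ[ℝ] V} {L : V →ₗ[ℝ] V →ₗ[ℝ] V} {𝔞 : Submodule ℝ V} {e : V} {b : ℝ} {v : V}
  {α β C : ℝ}

namespace IsCodimTwoFamily

/-- The function `⟪w, L w e⟫ - √-1 ⟪w, J (L w e)⟫` is, up to conjugation, a complex quadratic form,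
and `hD` says that its modulus is a nonzero multiple of `|w|²`. This is possible only in complex
dimension at most one. -/
lemma eq_zero_of_inner_eq_zero (h : IsCodimTwoFamily J L 𝔞 e b v) {D : ℝ}
    (hD : ∀ w ∈ 𝔞, ⟪w, L w e⟫ ^ 2 + ⟪w, J (L w e)⟫ ^ 2 = D * ‖w‖ ^ 4) (hD0 : D ≠ 0) {w u : V}
    (hw : w ∈ 𝔞) (hu : u ∈ 𝔞) (hw0 : w ≠ 0) (h1 : ⟪w, u⟫ = 0) (h2 : ⟪J w, u⟫ = 0) : u = 0 := by
  have hs2 : ∀ u ∈ 𝔞, ⟪w, u⟫ = 0 → 2 * ⟪w, L w e⟫ * ⟪u, L u e⟫ + (⟪w, L u e⟫ + ⟪u, L w e⟫) ^ 2 +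
      2 * ⟪w, J (L w e)⟫ * ⟪u, J (L u e)⟫ + (⟪w, J (L u e)⟫ + ⟪u, J (L w e)⟫) ^ 2 =
      2 * D * ‖w‖ ^ 2 * ‖u‖ ^ 2 := by
    intro u hu h1
    have hn : ∀ s : ℝ, ‖w + s • u‖ ^ 2 = ‖w‖ ^ 2 + s ^ 2 * ‖u‖ ^ 2 := by
      intro s
      rw [← real_inner_self_eq_norm_sq, ← real_inner_self_eq_norm_sq, ← real_inner_self_eq_norm_sq]
      simp only [inner_add_left, inner_add_right, real_inner_smul_left, real_inner_smul_right, h1,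
        real_inner_comm w u]
      ring
    have key := quartic_coeff_eq_zero
      (a₀ := ⟪w, L w e⟫ ^ 2 + ⟪w, J (L w e)⟫ ^ 2 - D * ‖w‖ ^ 4)
      (a₁ := 2 * ⟪w, L w e⟫ * (⟪w, L u e⟫ + ⟪u, L w e⟫)
        + 2 * ⟪w, J (L w e)⟫ * (⟪w, J (L u e)⟫ + ⟪u, J (L w e)⟫))
      (a₂ := 2 * ⟪w, L w e⟫ * ⟪u, L u e⟫ + (⟪w, L u e⟫ + ⟪u, L w e⟫) ^ 2 +
        2 * ⟪w, J (L w e)⟫ * ⟪u, J (L u e)⟫ + (⟪w, J (L u e)⟫ + ⟪u, J (L w e)⟫) ^ 2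
        - 2 * D * ‖w‖ ^ 2 * ‖u‖ ^ 2)
      (a₃ := 2 * ⟪u, L u e⟫ * (⟪w, L u e⟫ + ⟪u, L w e⟫)
        + 2 * ⟪u, J (L u e)⟫ * (⟪w, J (L u e)⟫ + ⟪u, J (L w e)⟫))
      (a₄ := ⟪u, L u e⟫ ^ 2 + ⟪u, J (L u e)⟫ ^ 2 - D * ‖u‖ ^ 4) (fun s => by
        have h3 := hD _ (𝔞.add_mem hw (𝔞.smul_mem s hu))
        rw [show ‖w + s • u‖ ^ 4 = (‖w + s • u‖ ^ 2) ^ 2 by ring, hn] at h3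
        simp only [map_add, map_smul, LinearMap.add_apply, LinearMap.smul_apply, inner_add_left,
          inner_add_right, real_inner_smul_left, real_inner_smul_right] at h3
        linear_combination h3)
    linarith [key.2.2.1]
  -- Comparing the coefficients of `s²` for `u` and `J u` isolates the real part of the product of
  -- the value at `w` with the conjugate of the value at `u`.
  have hcross : ∀ u ∈ 𝔞, ⟪w, u⟫ = 0 → ⟪J w, u⟫ = 0 →
      ⟪w, L w e⟫ * ⟪u, L u e⟫ + ⟪w, J (L w e)⟫ * ⟪u, J (L u e)⟫ = 0 := by
    intro u hu h1 h2
    have a1 := hs2 u hu h1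
    have a2 := hs2 (J u) (h.J_mem u hu) (by rw [h.inner_J_left] at h2; linarith)
    simp only [h.J_left, map_neg, h.J_J, inner_neg_right, neg_neg, h.inner_J_J, h.inner_J_left u,
      h.norm_J] at a2
    linear_combination (1 / 4) * a1 - (1 / 4) * a2
  have c1 := hcross u hu h1 h2
  have hJu1 : ⟪w, J u⟫ = 0 := by rw [h.inner_J_left] at h2; linarith
  -- Passing from `u` to `u + J u` multiplies the value of the quadratic form by an imaginary
  -- number, which gives the other part of the product.
  have c2 := hcross (u + J u) (𝔞.add_mem hu (h.J_mem u hu))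
    (by rw [inner_add_right, h1, hJu1, add_zero])
    (by rw [inner_add_right, h2, h.inner_J_J, h1, add_zero])
  simp only [map_add, LinearMap.add_apply, h.J_left, map_neg, h.J_J, inner_neg_right, neg_neg,
    inner_add_left, inner_add_right, h.inner_J_J, h.inner_J_left u] at c2
  have d1 := hD w hw
  have d2 := hD u hu
  by_contra hu0
  have p1 : D * ‖w‖ ^ 4 ≠ 0 := mul_ne_zero hD0 (pow_ne_zero _ (norm_ne_zero_iff.2 hw0))
  have p2 : D * ‖u‖ ^ 4 ≠ 0 := mul_ne_zero hD0 (pow_ne_zero _ (norm_ne_zero_iff.2 hu0))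
  refine mul_ne_zero p1 p2 ?_
  rw [← d1, ← d2]
  generalize ⟪w, L w e⟫ = f1 at *
  generalize ⟪u, L u e⟫ = f2 at *
  generalize ⟪w, J (L w e)⟫ = g1 at *
  generalize ⟪u, J (L u e)⟫ = g2 at *
  have c3 : g1 * f2 - f1 * g2 = 0 := by linarith
  linear_combination (f1 * f2 + g1 * g2) * c1 + (g1 * f2 - f1 * g2) * c3

variable [FiniteDimensional ℝ V]

/-- These are the coefficients of `1`, `s²`, `s³`, `s⁴` in the identity at `e + s w`; `ρ` is the
constant value of the Ricci term. -/
lemma mixed_coeff (h : IsCodimTwoFamily J L 𝔞 e b v) {ι : Type*} [Fintype ι]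
    (c : OrthonormalBasis ι ℝ 𝔞)
    (hmix : ∀ x, α * (-LinearMap.trace ℝ V (L (L x x))) * ‖x‖ ^ 2 + β * quarticForm L x =
      C * ‖x‖ ^ 4) {ρ : ℝ} (hρ : ρ = -(b * (2 * b + ∑ j, ⟪(c j : V), L e (c j)⟫)))
    {w : V} (hw : w ∈ 𝔞) :
    α * ρ - β * (‖v‖ ^ 2 + 2 * b ^ 2) = C ∧
    α * ρ * ‖w‖ ^ 2 + β * (⟪w, v⟫ ^ 2 + 2 * b * ⟪w, L w e⟫ + ⟪w, J v⟫ ^ 2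
      + ‖𝔞.starProjection (adjointFamily L e w)‖ ^ 2 - ‖L e w + L w e‖ ^ 2
      - 2 * ⟪b • L e w + L (L e w) e + L (L w e) e, w⟫) = 2 * C * ‖w‖ ^ 2 ∧
    β * (⟪w, v⟫ * ⟪w, L w e⟫ + ⟪w, J v⟫ * ⟪w, J (L w e)⟫) = 0 ∧
    β * (⟪w, L w e⟫ ^ 2 + ⟪w, J (L w e)⟫ ^ 2) = C * ‖w‖ ^ 4 := by
  have hew : ⟪e, w⟫ = 0 := by rw [real_inner_comm, h.inner_mem_e w hw]
  have hnorm : ∀ s : ℝ, ‖e + s • w‖ ^ 2 = 1 + s ^ 2 * ‖w‖ ^ 2 := by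
    intro s
    rw [← real_inner_self_eq_norm_sq, ← real_inner_self_eq_norm_sq]
    simp only [inner_add_left, inner_add_right, real_inner_smul_left, real_inner_smul_right,
      h.inner_e_e, hew, h.inner_mem_e w hw]
    ring
  have hy : ∀ s : ℝ, v + s • (L e w + L w e) ∈ 𝔞 := fun s =>
    𝔞.add_mem h.v_mem (𝔞.smul_mem _ (𝔞.add_mem (h.e_left_mem w hw) (h.e_right_mem w hw)))
  have hv : ∀ s : ℝ, ‖v + s • (L e w + L w e)‖ ^ 2 = ‖v‖ ^ 2 + 2 * s * ⟪v, L e w + L w e⟫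
      + s ^ 2 * ‖L e w + L w e‖ ^ 2 := by
    intro s
    generalize L e w + L w e = y
    rw [← real_inner_self_eq_norm_sq, ← real_inner_self_eq_norm_sq, ← real_inner_self_eq_norm_sq]
    simp only [inner_add_left, inner_add_right, real_inner_smul_left, real_inner_smul_right,
      real_inner_comm v y]
    ring
  have key := quartic_coeff_eq_zero (a₀ := α * ρ - β * (‖v‖ ^ 2 + 2 * b ^ 2) - C)
    (a₁ := β * (2 * b * ⟪w, v⟫ - 2 * ⟪v, L e w + L w e⟫ - 2 * ⟪b • v + L v e, w⟫))
    (a₂ := α * ρ * ‖w‖ ^ 2 + β * (⟪w, v⟫ ^ 2 + 2 * b * ⟪w, L w e⟫ + ⟪w, J v⟫ ^ 2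
      + ‖𝔞.starProjection (adjointFamily L e w)‖ ^ 2 - ‖L e w + L w e‖ ^ 2
      - 2 * ⟪b • L e w + L (L e w) e + L (L w e) e, w⟫) - 2 * C * ‖w‖ ^ 2)
    (a₃ := 2 * (β * (⟪w, v⟫ * ⟪w, L w e⟫ + ⟪w, J v⟫ * ⟪w, J (L w e)⟫)))
    (a₄ := β * (⟪w, L w e⟫ ^ 2 + ⟪w, J (L w e)⟫ ^ 2) - C * ‖w‖ ^ 4) (fun s => by
      have h1 := hmix (e + s • w)
      rw [h.quarticForm_eq hw, h.left_self hw, h.trace_left c (hy s), ← hρ,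
        show ‖e + s • w‖ ^ 4 = (‖e + s • w‖ ^ 2) ^ 2 by ring, hnorm, hv] at h1
      linear_combination h1)
  obtain ⟨k0, -, k2, k3, k4⟩ := key
  exact ⟨by linarith, by linarith, by linarith, by linarith⟩

/-- Half the sum and a quarter of the difference of the quadratic coefficients at `w` and `J w`: the
terms invariant under `J`, and those that change sign. -/
lemma mixed_average (h : IsCodimTwoFamily J L 𝔞 e b v) {ι : Type*} [Fintype ι]
    (c : OrthonormalBasis ι ℝ 𝔞)
    (hmix : ∀ x, α * (-LinearMap.trace ℝ V (L (L x x))) * ‖x‖ ^ 2 + β * quarticForm L x =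
      C * ‖x‖ ^ 4) {ρ : ℝ} (hρ : ρ = -(b * (2 * b + ∑ j, ⟪(c j : V), L e (c j)⟫)))
    {w : V} (hw : w ∈ 𝔞) :
    α * ρ * ‖w‖ ^ 2 + β * (⟪w, v⟫ ^ 2 + ⟪w, J v⟫ ^ 2
      + ‖𝔞.starProjection (adjointFamily L e w)‖ ^ 2 - ‖L e w‖ ^ 2 - ‖L w e‖ ^ 2
      - 2 * b * ⟪w, L e w⟫ - 2 * ⟪w, L (L w e) e⟫) = 2 * C * ‖w‖ ^ 2 ∧
    β * (b * ⟪w, L w e⟫ - ⟪L e w, L w e⟫ - ⟪w, L (L e w) e⟫) = 0 := by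
  have h1 := (h.mixed_coeff c hmix hρ hw).2.1
  have h2 := (h.mixed_coeff c hmix hρ (h.J_mem w hw)).2.1
  have hB : ‖𝔞.starProjection (adjointFamily L e (J w))‖ ^ 2 =
      ‖𝔞.starProjection (adjointFamily L e w)‖ ^ 2 := by
    have h3 := h.norm_sq_eq (adjointFamily L e (J w))
    have h4 := h.norm_sq_eq (adjointFamily L e w)
    rw [h.adjoint_map_J, h.norm_J] at h3
    rw [h.adjoint_map_J]
    rw [h.inner_J_J, h.inner_J_left] at h3
    linarith
  have e1 : ⟪J w, v⟫ = -⟪w, J v⟫ := h.inner_J_left w v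
  simp only [hB, e1, h.inner_J_J, h.norm_J, h.map_J, h.J_left, map_neg, LinearMap.neg_apply,
    neg_neg, inner_neg_right, ← sub_eq_add_neg, ← map_sub, inner_add_left,
    real_inner_smul_left, inner_sub_left] at h1 h2
  simp only [← real_inner_self_eq_norm_sq, inner_add_left, inner_add_right, inner_sub_left,
    inner_sub_right, real_inner_comm (L e w) (L w e), real_inner_comm w (L e w),
    real_inner_comm w (L (L e w) e), real_inner_comm w (L (L w e) e)] at h1 h2 ⊢
  constructor
  · linear_combination (1 / 2) * h1 + (1 / 2) * h2
  · linear_combination (1 / 4) * h1 - (1 / 4) * h2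

/-- The trace over `𝔞` of the averaged coefficient; the Hilbert–Schmidt norms of `A` and of its
adjoint cancel. -/
lemma mixed_sum (h : IsCodimTwoFamily J L 𝔞 e b v) {ι : Type*} [Fintype ι]
    (c : OrthonormalBasis ι ℝ 𝔞)
    (hmix : ∀ x, α * (-LinearMap.trace ℝ V (L (L x x))) * ‖x‖ ^ 2 + β * quarticForm L x =
      C * ‖x‖ ^ 4) {ρ : ℝ} (hρ : ρ = -(b * (2 * b + ∑ j, ⟪(c j : V), L e (c j)⟫))) :
    α * ρ * Fintype.card ι + β * (2 * ‖v‖ ^ 2 - ∑ j, ‖L (c j : V) e‖ ^ 2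
      - 2 * b * ∑ j, ⟪(c j : V), L e (c j)⟫ - 2 * ∑ j, ⟪(c j : V), L (L (c j : V) e) e⟫) =
      2 * C * Fintype.card ι := by
  have h1 := Finset.sum_congr rfl fun j (_ : j ∈ Finset.univ) =>
    (h.mixed_average c hmix hρ (c j).2).1
  have hc : ∀ j, ‖(c j : V)‖ = 1 := fun j => c.orthonormal.1 j
  have hsum : ∀ u ∈ 𝔞, ∑ j, ⟪(c j : V), u⟫ ^ 2 = ‖u‖ ^ 2 := by
    intro u hu
    have := c.sum_sq_norm_inner_right ⟨u, hu⟩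
    simpa using this
  have hB := sum_norm_sq_adjoint_restrict c (L e) h.e_left_mem
  simp only [← adjointFamily_apply] at hB
  have hvJ := hsum _ (h.J_mem v h.v_mem)
  rw [h.norm_J] at hvJ
  simp only [hc, one_pow, mul_one, Finset.sum_add_distrib, Finset.sum_sub_distrib, ← Finset.mul_sum,
    Finset.sum_const, Finset.card_univ, nsmul_eq_mul, hsum v h.v_mem, hvJ, hB] at h1
  linear_combination h1

end IsCodimTwoFamily

end CodimTwoMixed

/-! ### Rigidity of families of codimension two -/

section CodimTwoRigidity

variable {V : Type*} [NormedAddCommGroup V] [InnerProductSpace ℝ V] [FiniteDimensional ℝ V]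
  {J : V →ₗ[ℝ] V} {L : V →ₗ[ℝ] V →ₗ[ℝ] V} {𝔞 : Submodule ℝ V} {e : V} {b : ℝ} {v : V}
  {α β C : ℝ}

namespace IsCodimTwoFamily

/-- Otherwise `C = β D` with `D ≠ 0`, the cubic coefficient gives `v = 0`, and every unit vector of
`𝔞` spans it over the complex numbers. The one-dimensional data `⟪u, A u⟫ = b / 2`, `⟪u, T² u⟫ = |T
u|² = D` then contradict the trace identity. -/
lemma inner_right_eq_zero (h : IsCodimTwoFamily J L 𝔞 e b v) {ι : Type*} [Fintype ι]
    (c : OrthonormalBasis ι ℝ 𝔞)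
    (htr : ∑ j, ⟪(c j : V), L (L (c j : V) e) e⟫ = 2 * b * (b + ∑ j, ⟪(c j : V), L e (c j)⟫))
    (hmix : ∀ x, α * (-LinearMap.trace ℝ V (L (L x x))) * ‖x‖ ^ 2 + β * quarticForm L x =
      C * ‖x‖ ^ 4) (hβ : β ≠ 0) {w : V} (hw : w ∈ 𝔞) : ⟪w, L w e⟫ = 0 := by
  by_contra hw1
  obtain ⟨ρ, hρ⟩ : ∃ ρ, ρ = -(b * (2 * b + ∑ j, ⟪(c j : V), L e (c j)⟫)) := ⟨_, rfl⟩
  obtain ⟨D, hCD⟩ : ∃ D, C = β * D := ⟨C / β, by field_simp⟩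
  have hD : ∀ w ∈ 𝔞, ⟪w, L w e⟫ ^ 2 + ⟪w, J (L w e)⟫ ^ 2 = D * ‖w‖ ^ 4 := by
    intro w hw
    have := (h.mixed_coeff c hmix hρ hw).2.2.2
    rw [hCD, mul_assoc] at this
    exact mul_left_cancel₀ hβ this
  have hD0 : D ≠ 0 := by
    rintro rfl
    have := hD w hw
    exact hw1 (by nlinarith [sq_nonneg ⟪w, J (L w e)⟫, sq_nonneg ⟪w, L w e⟫])
  have hv : v = 0 := by
    by_contra hv0
    have hvm := h.v_mem
    have h1 := (h.mixed_coeff c hmix hρ hvm).2.2.1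
    have h2 := (h.mixed_coeff c hmix hρ (h.J_mem v hvm)).2.2.1
    have hvJ : ⟪v, J v⟫ = 0 := by
      have := h.inner_J_left v v
      rw [real_inner_comm] at this
      linarith
    rw [hvJ] at h1
    simp only [h.inner_J_J, h.J_left, map_neg, h.inner_J_left v, hvJ, inner_neg_right] at h2
    have hvv : ⟪v, v⟫ ≠ 0 := by rwa [Ne, inner_self_eq_zero]
    have f0 : ⟪v, L v e⟫ = 0 := by
      have := (mul_eq_zero.1 h1).resolve_left hβ
      rw [zero_mul, add_zero] at this
      exact (mul_eq_zero.1 this).resolve_left hvv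
    have g0 : ⟪v, J (L v e)⟫ = 0 := by
      have := (mul_eq_zero.1 h2).resolve_left hβ
      simp [h.J_J] at this
      exact this.resolve_left hv0
    have := hD v hvm
    rw [f0, g0] at this
    simp at this
    exact this.elim hD0 hv0
  subst hv
  have hdec : ∀ u ∈ 𝔞, ‖u‖ = 1 → ∀ z ∈ 𝔞, z = ⟪u, z⟫ • u + ⟪J u, z⟫ • J u := by
    intro u hu hu1 z hz
    have huu : ⟪u, u⟫ = 1 := by rw [real_inner_self_eq_norm_sq, hu1, one_pow]
    have huJ : ⟪u, J u⟫ = 0 := by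
      have := h.inner_J_left u u
      rw [real_inner_comm] at this
      linarith
    rw [← sub_eq_zero]
    refine h.eq_zero_of_inner_eq_zero hD hD0 hu (𝔞.sub_mem hz (𝔞.add_mem (𝔞.smul_mem _ hu)
      (𝔞.smul_mem _ (h.J_mem u hu)))) (by rintro rfl; simp at hu1) ?_ ?_
    · simp only [inner_sub_right, inner_add_right, real_inner_smul_right, huu, huJ]
      ring
    · simp only [inner_sub_right, inner_add_right, real_inner_smul_right, h.inner_J_J, huu,
        h.inner_J_left u u, huJ]
      ring
  have hunit : ∀ u ∈ 𝔞, ‖u‖ = 1 → ⟪u, L e u⟫ = b / 2 ∧ ⟪u, L (L u e) e⟫ = D ∧ ‖L u e‖ ^ 2 = D := by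
    intro u hu hu1
    have huu : ⟪u, u⟫ = 1 := by rw [real_inner_self_eq_norm_sq, hu1, one_pow]
    have huJ : ⟪u, J u⟫ = 0 := by
      have := h.inner_J_left u u
      rw [real_inner_comm] at this
      linarith
    have huJ' : ⟪J u, u⟫ = 0 := by rw [h.inner_J_left, huJ, neg_zero]
    have hJuJu : ⟪J u, J u⟫ = 1 := by rw [h.inner_J_J, huu]
    have hA := hdec u hu hu1 _ (h.e_left_mem u hu)
    have hT := hdec u hu hu1 _ (h.e_right_mem u hu)
    have hDu := hD u hu
    rw [hu1, one_pow, mul_one] at hDu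
    have hJT : ⟪J u, L u e⟫ = -⟪u, J (L u e)⟫ := h.inner_J_left _ _
    rw [hJT] at hT
    have a1 := (h.mixed_average c hmix hρ hu).2
    have a2 := (h.mixed_average c hmix hρ (𝔞.add_mem hu (h.J_mem u hu))).2
    replace a1 := (mul_eq_zero.1 a1).resolve_left hβ
    replace a2 := (mul_eq_zero.1 a2).resolve_left hβ
    generalize ⟪u, L u e⟫ = t1 at *
    generalize ⟪u, J (L u e)⟫ = t2 at *
    generalize ⟪u, L e u⟫ = a1' at *
    generalize ⟪J u, L e u⟫ = a2' at *
    simp only [map_add, LinearMap.add_apply, h.map_J, h.J_left, hA, hT, map_smul,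
      LinearMap.smul_apply, map_neg, LinearMap.neg_apply, h.J_J, inner_add_left, inner_add_right,
      real_inner_smul_left, real_inner_smul_right, inner_neg_left, inner_neg_right, huu, huJ, huJ',
      hJuJu, smul_add, smul_neg] at a1 a2
    have e1 : (b - 2 * a1') * t1 + 2 * a2' * t2 = 0 := by linear_combination a1
    have e2 : (b - 2 * a1') * t2 - 2 * a2' * t1 = 0 := by linear_combination (-1 / 2) * a2
    have e3 : (b - 2 * a1') * D = 0 := by
      rw [← hDu]; linear_combination t1 * e1 + t2 * e2
    refine ⟨?_, ?_, ?_⟩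
    · have := (mul_eq_zero.1 e3).resolve_right hD0
      linarith
    · rw [hT]
      simp only [map_add, LinearMap.add_apply, h.J_left, hT, map_smul,
        LinearMap.smul_apply, h.J_J, inner_add_right,
        real_inner_smul_right, inner_neg_right, huu, huJ, smul_neg]
      linear_combination hDu
    · rw [← real_inner_self_eq_norm_sq, hT]
      simp only [inner_add_left, inner_add_right,
        real_inner_smul_left, real_inner_smul_right, huu, huJ, huJ', hJuJu]
      linear_combination hDu
  have hc : ∀ j, ‖(c j : V)‖ = 1 := fun j => c.orthonormal.1 j
  have hsum := h.mixed_sum c hmix hρ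
  have h0 := (h.mixed_coeff c hmix hρ hw).1
  simp only [fun j => (hunit _ (c j).2 (hc j)).1, fun j => (hunit _ (c j).2 (hc j)).2.1,
    fun j => (hunit _ (c j).2 (hc j)).2.2, Finset.sum_const, Finset.card_univ, nsmul_eq_mul]
    at hsum htr
  have hm : (1 : ℝ) ≤ Fintype.card ι := by
    have : Nonempty ι := by
      by_contra hemp
      rw [not_nonempty_iff] at hemp
      have h1 := c.sum_repr ⟨w, hw⟩
      simp only [Finset.univ_eq_empty, Finset.sum_empty] at h1
      have : w = 0 := congrArg Subtype.val h1.symm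
      exact hw1 (by simp [this])
    exact_mod_cast Fintype.card_pos
  generalize (Fintype.card ι : ℝ) = m at *
  have hm0 : m ≠ 0 := by linarith
  subst hCD
  -- The traced identity minus `m` times the constant coefficient eliminates the Ricci term and
  -- leaves `b² = 4 D`, where `m` is the real dimension of `𝔞`.
  have q1 : β * (b ^ 2 - 4 * D) = 0 := by
    have : m * (β * (b ^ 2 - 4 * D)) = 0 := by
      simp only [norm_zero] at hsum h0
      linear_combination hsum - m * h0
    exact (mul_eq_zero.1 this).resolve_left hm0
  have q2 : b ^ 2 = 4 * D := by
    have := (mul_eq_zero.1 q1).resolve_left hβ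
    linarith
  -- The trace identity `htr` now reads `m D = (2 + m) b²`.
  have q3 : D * (8 + 3 * m) = 0 := by linear_combination (-1) * htr - (2 + m) * q2
  rcases mul_eq_zero.1 q3 with q | q
  · exact hD0 q
  · linarith

/-- Now `T` is skew, so `tr T² = -|T|²`. Eliminating `ρ` and `tr A` among the traced identity, the
constant coefficient and `htr` leaves a vanishing sum of squares, whence `v = 0`, `b = 0`, `T = 0`.
The averaged coefficient then reads `|A* w| = |A w|`. -/
lemma rigid (h : IsCodimTwoFamily J L 𝔞 e b v) {ι : Type*} [Fintype ι]
    (c : OrthonormalBasis ι ℝ 𝔞)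
    (htr : ∑ j, ⟪(c j : V), L (L (c j : V) e) e⟫ = 2 * b * (b + ∑ j, ⟪(c j : V), L e (c j)⟫))
    (hmix : ∀ x, α * (-LinearMap.trace ℝ V (L (L x x))) * ‖x‖ ^ 2 + β * quarticForm L x =
      C * ‖x‖ ^ 4) (hβ : β ≠ 0) :
    C = 0 ∧ L e e = 0 ∧ (∀ w ∈ 𝔞, L w = 0) ∧
      ∀ x z, L x (adjointFamily L x z) = adjointFamily L x (L x z) := by
  obtain ⟨ρ, hρ⟩ : ∃ ρ, ρ = -(b * (2 * b + ∑ j, ⟪(c j : V), L e (c j)⟫)) := ⟨_, rfl⟩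
  have hf : ∀ w ∈ 𝔞, ⟪w, L w e⟫ = 0 := fun w hw => h.inner_right_eq_zero c htr hmix hβ hw
  have hskew : ∀ w ∈ 𝔞, ∀ u ∈ 𝔞, ⟪w, L u e⟫ = -⟪L w e, u⟫ := by
    intro w hw u hu
    have := hf (w + u) (𝔞.add_mem hw hu)
    simp only [map_add, LinearMap.add_apply, inner_add_left, inner_add_right, hf w hw, hf u hu]
      at this
    rw [real_inner_comm u]
    linarith
  have hT2 : ∑ j, ⟪(c j : V), L (L (c j : V) e) e⟫ = -∑ j, ‖L (c j : V) e‖ ^ 2 := by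
    rw [← Finset.sum_neg_distrib]
    refine Finset.sum_congr rfl fun j _ => ?_
    rw [hskew _ (c j).2 _ (h.e_right_mem _ (c j).2), real_inner_self_eq_norm_sq]
  have hCw : ∀ w ∈ 𝔞, w ≠ 0 → C = 0 := by
    intro w hw hw0
    have h1 := (h.mixed_coeff c hmix hρ hw).2.2.2
    -- At `w + J w` the real part of the quadratic form is a multiple of its other part at `w`, so
    -- both parts vanish.
    have h2 := hf (w + J w) (𝔞.add_mem hw (h.J_mem w hw))
    simp only [map_add, LinearMap.add_apply, inner_add_left, inner_add_right, h.J_left,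
      inner_neg_right, h.inner_J_J, hf w hw, h.inner_J_left w] at h2
    have h3 : ⟪w, J (L w e)⟫ = 0 := by linarith
    rw [hf w hw, h3] at h1
    simp at h1
    exact h1.resolve_right hw0
  have hCm : C * Fintype.card ι = 0 := by
    by_cases hemp : IsEmpty ι
    · simp
    · rw [not_isEmpty_iff] at hemp
      obtain ⟨j⟩ := hemp
      rw [hCw (c j) (c j).2 (by
        have := c.orthonormal.ne_zero j
        simpa using this), zero_mul]
  have hsum := h.mixed_sum c hmix hρ
  have h0 := (h.mixed_coeff c hmix hρ 𝔞.zero_mem).1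
  rw [hT2] at hsum htr
  set t := ∑ j, ‖L (c j : V) e‖ ^ 2 with ht
  have ht0 : 0 ≤ t := Finset.sum_nonneg fun j _ => sq_nonneg _
  have hm : (0 : ℝ) ≤ Fintype.card ι := Nat.cast_nonneg _
  have key : 2 * ‖v‖ ^ 2 + 2 * t + 2 * b ^ 2 +
      (Fintype.card ι : ℝ) * (‖v‖ ^ 2 + 2 * b ^ 2) = 0 := by
    refine (mul_eq_zero.1 ?_).resolve_left hβ
    linear_combination hsum - (Fintype.card ι : ℝ) * h0 - β * htr + hCm
  have hmv : 0 ≤ (Fintype.card ι : ℝ) * (‖v‖ ^ 2 + 2 * b ^ 2) := by positivity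
  have hv : v = 0 := by
    have : ‖v‖ ^ 2 = 0 := by nlinarith [sq_nonneg ‖v‖, sq_nonneg b]
    simpa using this
  have hb : b = 0 := by
    have : b ^ 2 = 0 := by nlinarith [sq_nonneg ‖v‖, sq_nonneg b]
    simpa using this
  have htz : t = 0 := by nlinarith [sq_nonneg ‖v‖, sq_nonneg b]
  subst hv hb
  have hρ0 : ρ = 0 := by rw [hρ]; ring
  have hC : C = 0 := by
    rw [hρ0] at h0
    simp at h0
    exact h0.symm
  have hee : L e e = 0 := by rw [h.e_e]; simp
  have hTc : ∀ j, L (c j : V) e = 0 := by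
    rw [ht, Finset.sum_eq_zero_iff_of_nonneg (fun j _ => sq_nonneg _)] at htz
    intro j
    simpa using htz j (Finset.mem_univ _)
  have hT : ∀ w ∈ 𝔞, L w e = 0 := by
    intro w hw
    have hw' := congrArg (Subtype.val) (c.sum_repr ⟨w, hw⟩)
    simp only [Submodule.coe_sum, Submodule.coe_smul] at hw'
    rw [← hw']
    simp only [map_sum, map_smul, LinearMap.sum_apply, LinearMap.smul_apply, hTc, smul_zero,
      Finset.sum_const_zero]
  have hdec : ∀ x, x = 𝔞.starProjection x + ⟪x, e⟫ • e + ⟪x, J e⟫ • J e := by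
    intro x
    rw [h.starProjection_eq]; abel
  have hLw : ∀ w ∈ 𝔞, L w = 0 := by
    intro w hw
    refine LinearMap.ext fun x => ?_
    rw [hdec x]
    simp [h.map_J, hT w hw, h.left_eq_zero w hw _ (Submodule.starProjection_apply_mem 𝔞 x)]
  refine ⟨hC, hee, hLw, ?_⟩
  have hLe : ∀ x, L e x = L e (𝔞.starProjection x) := by
    intro x
    conv_lhs => rw [hdec x]
    simp [h.map_J, hee]
  have hae : adjointFamily L e e = 0 := by
    refine ext_inner_right ℝ fun y => ?_
    rw [inner_adjointFamily_left, hLe, real_inner_comm, inner_zero_left]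
    exact h.inner_mem_e _ (h.e_left_mem _ (Submodule.starProjection_apply_mem 𝔞 y))
  have haLe : ∀ x, adjointFamily L e x = adjointFamily L e (𝔞.starProjection x) := by
    intro x
    conv_lhs => rw [hdec x]
    simp [h.adjoint_map_J, hae]
  have hamem : ∀ w, 𝔞.starProjection (adjointFamily L e w) = adjointFamily L e w := by
    intro w
    rw [h.starProjection_eq, inner_adjointFamily_left, inner_adjointFamily_left, h.map_J, hee]
    simp
  have hnorm : ∀ x, ⟪adjointFamily L e x, adjointFamily L e x⟫ = ⟪L e x, L e x⟫ := by
    intro x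
    rw [hLe x, haLe x]
    have hp := Submodule.starProjection_apply_mem 𝔞 x
    generalize 𝔞.starProjection x = w at *
    have h1 := (h.mixed_average c hmix hρ hp).1
    rw [hT w hp, hamem, hρ0, hC] at h1
    simp only [map_zero, LinearMap.zero_apply, inner_zero_right, norm_zero] at h1
    rw [real_inner_self_eq_norm_sq, real_inner_self_eq_norm_sq]
    have h2 : β * (‖adjointFamily L e w‖ ^ 2 - ‖L e w‖ ^ 2) = 0 := by linear_combination h1
    have := (mul_eq_zero.1 h2).resolve_left hβ
    linarith
  have hpol : ∀ x y, ⟪adjointFamily L e x, adjointFamily L e y⟫ = ⟪L e x, L e y⟫ := by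
    intro x y
    have h1 := hnorm (x + y)
    simp only [map_add, inner_add_left, inner_add_right, hnorm x, hnorm y,
      real_inner_comm (L e x) (L e y),
      real_inner_comm (adjointFamily L e x) (adjointFamily L e y)] at h1
    linarith
  have hcomm : ∀ z, L e (adjointFamily L e z) = adjointFamily L e (L e z) := by
    intro z
    refine ext_inner_right ℝ fun y => ?_
    rw [← inner_adjointFamily_right, hpol, inner_adjointFamily_left]
  intro x z
  have h1 : ∀ y, L x y = ⟪x, e⟫ • L e y - ⟪x, J e⟫ • J (L e y) := by
    intro y
    conv_lhs => rw [hdec x]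
    simp only [map_add, map_smul, LinearMap.add_apply, LinearMap.smul_apply,
      hLw _ (Submodule.starProjection_apply_mem 𝔞 x), h.J_left, LinearMap.zero_apply, smul_neg]
    abel
  have h2 : ∀ y, adjointFamily L x y =
      ⟪x, e⟫ • adjointFamily L e y + ⟪x, J e⟫ • J (adjointFamily L e y) := by
    intro y
    refine ext_inner_right ℝ fun z => ?_
    rw [inner_adjointFamily_left, h1 z, inner_sub_right, inner_add_left, real_inner_smul_left,
      real_inner_smul_left, real_inner_smul_right, real_inner_smul_right, inner_adjointFamily_left,
      h.inner_J_left, inner_adjointFamily_left, h.map_J]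
    ring
  rw [h1, h2, h2, h1]
  simp only [map_add, map_sub, map_smul, h.map_J, h.adjoint_map_J, hcomm, h.J_J]
  module

end IsCodimTwoFamily

end CodimTwoRigidity

/-! ## Hermitian brackets with an abelian complex ideal of codimension two -/

section CodimTwoBracket

/-- Here `J T = -[J, P]`, so `tr (J [P, Q]) = -tr (J T Q)`. Since `J T` is antilinear, only the
antilinear part of `Q`, which is `-J T / 2`, contributes. -/
lemma trace_complexStructure_mul_commutator {W : Type*} [AddCommGroup W] [Module ℝ W]
    {J P Q T : Module.End ℝ W} (hJ : J * J = -1) (hT : T = -(P + J * P * J))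
    (hQ : J * T = -(Q + J * Q * J)) :
    2 * LinearMap.trace ℝ W (J * (P * Q - Q * P)) = LinearMap.trace ℝ W (T * T) := by
  have hJT : J * T = -(J * P - P * J) := by
    rw [hT]
    linear_combination (norm := noncomm_ring) -hJ * (P * J)
  have hTJ : T * J = -(J * T) := by
    rw [hJT, hT]
    linear_combination (norm := noncomm_ring) -(J * P) * hJ
  have h1 : LinearMap.trace ℝ W (J * (P * Q - Q * P)) = -LinearMap.trace ℝ W (J * T * Q) := by
    have : LinearMap.trace ℝ W (J * Q * P) = LinearMap.trace ℝ W (P * J * Q) := by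
      rw [LinearMap.trace_mul_comm, mul_assoc]
    rw [mul_sub, ← mul_assoc, ← mul_assoc, map_sub, this, hJT, ← map_sub, ← map_neg]
    congr 1
    noncomm_ring
  have h2 : LinearMap.trace ℝ W (J * T * (J * Q * J)) = LinearMap.trace ℝ W (J * T * Q) := by
    rw [show J * T * (J * Q * J) = (J * T * (J * Q)) * J by noncomm_ring, LinearMap.trace_mul_comm]
    congr 1
    rw [show J * (J * T * (J * Q)) = (J * J) * (T * J) * Q by noncomm_ring, hJ, hTJ]
    noncomm_ring
  have h3 : LinearMap.trace ℝ W (J * T * (Q + J * Q * J)) = -LinearMap.trace ℝ W (T * T) := by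
    rw [show Q + J * Q * J = -(J * T) by rw [hQ, neg_neg], ← map_neg]
    congr 1
    rw [show J * T * -(J * T) = -(J * (T * J) * T) by noncomm_ring, hTJ,
      show J * -(J * T) = -((J * J) * T) by noncomm_ring, hJ]
    noncomm_ring
  rw [mul_add, map_add, h2] at h3
  rw [h1]
  linarith

variable {V : Type*} [NormedAddCommGroup V] [InnerProductSpace ℝ V] [FiniteDimensional ℝ V]
  {J : V →ₗ[ℝ] V} {br : V →ₗ[ℝ] V →ₗ[ℝ] V} {𝔞 : Submodule ℝ V}

namespace IsHermitianBracket

/-- Rotating a vector in the complex line `𝔞ᗮ` makes the coefficient of `L e e` along `e` real. -/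
lemma exists_isCodimTwoFamily (h : IsHermitianBracket J br) (haJ : ∀ w ∈ 𝔞, J w ∈ 𝔞)
    (hab : ∀ w ∈ 𝔞, ∀ u ∈ 𝔞, br w u = 0) (hid : ∀ x, ∀ w ∈ 𝔞, br x w ∈ 𝔞)
    (hdim : Module.finrank ℝ 𝔞 + 2 = Module.finrank ℝ V) :
    ∃ e b v, IsCodimTwoFamily J (bottFamily J br) 𝔞 e b v := by
  have hA := h.isAntilinearFamily
  set L := bottFamily J br with hL
  have hperp : Module.finrank ℝ 𝔞ᗮ = 2 := by
    have := Submodule.finrank_add_finrank_orthogonal 𝔞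
    omega
  have hJself : ∀ x, ⟪x, J x⟫ = 0 := by
    intro x
    have := hA.inner_J_left x x
    rw [real_inner_comm] at this
    linarith
  have hJperp : ∀ x ∈ 𝔞ᗮ, J x ∈ 𝔞ᗮ := by
    intro x hx n hn
    have := hx _ (haJ n hn)
    rw [hA.inner_J_left] at this
    linarith
  obtain ⟨e, he, hee, hb⟩ : ∃ e ∈ 𝔞ᗮ, ⟪e, e⟫ = 1 ∧ ⟪L e e, J e⟫ = 0 := by
    have hne : 𝔞ᗮ ≠ ⊥ := by
      intro hbot
      rw [hbot, finrank_bot] at hperp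
      omega
    obtain ⟨g, hg, hg0⟩ := Submodule.exists_mem_ne_zero_of_ne_bot hne
    have key : ∃ f ∈ 𝔞ᗮ, f ≠ 0 ∧ ⟪L f f, J f⟫ = 0 := by
      by_cases hb : ⟪L g g, J g⟫ = 0
      · exact ⟨g, hg, hg0, hb⟩
      · have hself : ∀ p q : ℝ, L (p • g + q • J g) (p • g + q • J g) =
            (p ^ 2 + q ^ 2) • L g g := by
          intro p q
          simp only [map_add, map_smul, LinearMap.add_apply, LinearMap.smul_apply, hA.J_left,
            hA.map_J, h.J_J]
          module
        -- By `hself` the direction of `L f f` does not depend on `f` in the plane of `g`, `J g`; so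
        -- take `f` along the projection of `L g g` to that plane.
        refine ⟨⟪L g g, g⟫ • g + ⟪L g g, J g⟫ • J g, Submodule.add_mem _ (Submodule.smul_mem _ _ hg)
          (Submodule.smul_mem _ _ (hJperp g hg)), fun h0 => hb ?_, ?_⟩
        · have := congrArg (fun x => ⟪J g, x⟫) h0
          simp only [inner_add_right, real_inner_smul_right, inner_zero_right, h.inner_J_J,
            real_inner_comm g (J g), hJself, mul_zero, zero_add] at this
          exact (mul_eq_zero.1 this).resolve_right (by rwa [inner_self_eq_zero])
        · rw [hself]
          simp only [map_add, map_smul, h.J_J, real_inner_smul_left, inner_add_right,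
            real_inner_smul_right, inner_neg_right]
          ring
    obtain ⟨f, hf, hf0, hfJ⟩ := key
    have hfn : ‖f‖ ≠ 0 := norm_ne_zero_iff.2 hf0
    refine ⟨(‖f‖⁻¹ : ℝ) • f, Submodule.smul_mem _ _ hf, ?_, ?_⟩
    · rw [real_inner_smul_left, real_inner_smul_right, real_inner_self_eq_norm_sq]
      field_simp
    · simp only [map_smul, LinearMap.smul_apply, real_inner_smul_left, real_inner_smul_right, hfJ,
        mul_zero]
  have hJe := hJperp e he
  have hJee : ⟪J e, J e⟫ = 1 := by rw [h.inner_J_J, hee]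
  have hspan : 𝔞ᗮ = Submodule.span ℝ (Set.range ![e, J e]) := by
    symm
    refine Submodule.eq_of_le_of_finrank_eq ?_ ?_
    · rw [Submodule.span_le]
      rintro _ ⟨i, rfl⟩
      fin_cases i
      · exact he
      · exact hJe
    · rw [hperp]
      have hli : LinearIndependent ℝ ![e, J e] := by
        rw [LinearIndependent.pair_iff]
        intro s t hst
        have h1 := congrArg (fun x => ⟪e, x⟫) hst
        have h2 := congrArg (fun x => ⟪J e, x⟫) hst
        simp only [inner_add_right, real_inner_smul_right, inner_zero_right, hee, hJee,
          real_inner_comm e (J e), hJself] at h1 h2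
        constructor <;> linarith
      rw [finrank_span_eq_card hli]
      simp
  have hsub : ∀ x, x - ⟪x, e⟫ • e - ⟪x, J e⟫ • J e ∈ 𝔞 := by
    intro x
    rw [← Submodule.orthogonal_orthogonal 𝔞, hspan, Submodule.mem_orthogonal]
    intro y hy
    induction hy using Submodule.span_induction with
    | mem y hy =>
      obtain ⟨i, rfl⟩ := hy
      fin_cases i
      · change ⟪e, _⟫ = 0
        rw [inner_sub_right, inner_sub_right, real_inner_smul_right, real_inner_smul_right, hee,
          hJself, real_inner_comm]
        ring
      · change ⟪J e, _⟫ = 0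
        rw [inner_sub_right, inner_sub_right, real_inner_smul_right, real_inner_smul_right, hJee,
          real_inner_comm e (J e), hJself, real_inner_comm]
        ring
    | zero => simp
    | add y z _ _ hy hz => rw [inner_add_left, hy, hz, add_zero]
    | smul a y _ hy => rw [real_inner_smul_left, hy, mul_zero]
  have hidL : ∀ x, ∀ w ∈ 𝔞, L x w ∈ 𝔞 := fun x w hw =>
    𝔞.add_mem (hid x w hw) (haJ _ (hid _ w hw))
  refine ⟨e, ⟪L e e, e⟫, L e e - ⟪L e e, e⟫ • e, ⟨hA, haJ, hee, fun w hw => he w hw, hsub, ?_,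
    fun w hw => hidL e w hw, ?_, by abel, ?_⟩⟩
  · intro w hw u hu
    rw [hL, bottFamily_apply, hab w hw u hu, hab _ (haJ w hw) u hu, map_zero, add_zero]
  · intro w hw
    rw [hL, bottFamily_apply, h.swap w e, h.swap (J w) e, map_neg]
    exact 𝔞.add_mem (𝔞.neg_mem (hid e w hw)) (𝔞.neg_mem (haJ _ (hid e _ (haJ w hw))))
  · have := hsub (L e e)
    rwa [hb, zero_smul, sub_zero] at this

/-- Let `P`, `Q` be the restrictions to `𝔞` of `ad e`, `ad (J e)`. As `[e, J e] = b J e + J v` and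
`𝔞` is abelian, `[P, Q] = b Q`, so `tr T² = 2 b tr (J Q)`. Unimodularity gives `tr P = -b`, hence
`tr (J Q) = tr A + b`. -/
lemma trace_right_sq (h : IsHermitianBracket J br) (hab : ∀ w ∈ 𝔞, ∀ u ∈ 𝔞, br w u = 0)
    (hid : ∀ x, ∀ w ∈ 𝔞, br x w ∈ 𝔞) (hu : ∀ x, LinearMap.trace ℝ V (br x) = 0)
    {e v : V} {b : ℝ} (hF : IsCodimTwoFamily J (bottFamily J br) 𝔞 e b v)
    {ι : Type*} [Fintype ι] (c : OrthonormalBasis ι ℝ 𝔞) :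
    ∑ j, ⟪(c j : V), bottFamily J br (bottFamily J br (c j : V) e) e⟫ =
      2 * b * (b + ∑ j, ⟪(c j : V), bottFamily J br e (c j)⟫) := by
  have heJ : br e (J e) = b • J e + J v := by
    have := h.bottFamily_self e
    rw [hF.e_e] at this
    have := congrArg J this
    rw [map_neg, h.J_J, neg_neg, map_add, map_smul] at this
    exact this.symm
  have hJee : ⟪J e, J e⟫ = 1 := by rw [h.inner_J_J, hF.inner_e_e]
  have tP := hu e
  rw [hF.trace_eq c, h.self, heJ, inner_zero_right, inner_add_right, real_inner_smul_right, hJee,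
    real_inner_comm (J v) (J e), hF.inner_mem_Je (hF.J_mem v hF.v_mem)] at tP
  have tQ := hu (J e)
  rw [hF.trace_eq c, h.self, h.swap (J e) e, heJ, inner_zero_right, inner_neg_right,
    inner_add_right, real_inner_smul_right, hF.inner_e_Je, real_inner_comm (J v) e,
    hF.inner_mem_e _ (hF.J_mem v hF.v_mem)] at tQ
  let P : Module.End ℝ 𝔞 := (br e).restrict (hid e)
  let Q : Module.End ℝ 𝔞 := (br (J e)).restrict (hid (J e))
  let I : Module.End ℝ 𝔞 := J.restrict hF.J_mem
  let T : Module.End ℝ 𝔞 := ((bottFamily J br).flip e).restrict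
    (show ∀ w ∈ 𝔞, (bottFamily J br).flip e w ∈ 𝔞 from hF.e_right_mem)
  have hI : I * I = -1 := by
    ext w
    simp [I, h.J_J]
  have hT : T = -(P + I * P * I) := by
    ext w
    simp only [T, P, I, LinearMap.coe_restrict_apply, LinearMap.flip_apply, bottFamily_apply,
      LinearMap.neg_apply, LinearMap.add_apply, Module.End.mul_apply, Submodule.coe_neg,
      Submodule.coe_add]
    rw [h.swap (w : V) e, h.swap (J w) e, map_neg]
    abel
  have hQ : I * T = -(Q + I * Q * I) := by
    ext w
    simp only [T, Q, I, LinearMap.coe_restrict_apply, LinearMap.flip_apply,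
      LinearMap.neg_apply, LinearMap.add_apply, Module.End.mul_apply, Submodule.coe_neg,
      Submodule.coe_add]
    rw [← hF.map_J, bottFamily_apply, h.swap (w : V) (J e), h.swap (J w) (J e), map_neg]
    abel
  have hPQ : P * Q - Q * P = b • Q := by
    ext w
    simp only [P, Q, LinearMap.sub_apply, Module.End.mul_apply, LinearMap.smul_apply,
      Submodule.coe_sub, Submodule.coe_smul, LinearMap.coe_restrict_apply]
    rw [h.jacobi e (J e), heJ, map_add, map_smul, LinearMap.add_apply, LinearMap.smul_apply,
      hab _ (hF.J_mem v hF.v_mem) w w.2]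
    abel
  have key := trace_complexStructure_mul_commutator hI hT hQ
  rw [hPQ, mul_smul_comm, map_smul, smul_eq_mul, LinearMap.trace_eq_sum_inner _ c,
    LinearMap.trace_eq_sum_inner _ c] at key
  have e1 : ∑ j, ⟪(c j : V), bottFamily J br (bottFamily J br (c j : V) e) e⟫ =
      ∑ j, ⟪c j, (T * T) (c j)⟫ := rfl
  have e2 : ∑ j, ⟪(c j : V), bottFamily J br e (c j)⟫ =
      ∑ j, ⟪(c j : V), br e (c j)⟫ + ∑ j, ⟪c j, (I * Q) (c j)⟫ := by
    rw [← Finset.sum_add_distrib]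
    refine Finset.sum_congr rfl fun j _ => ?_
    rw [bottFamily_apply, inner_add_right]
    rfl
  rw [e1, ← key, e2]
  have e3 : ∑ j, ⟪(c j : V), br e (c j)⟫ = -b := by linarith
  rw [e3]
  ring

theorem codimTwo_rigid (h : IsHermitianBracket J br) (haJ : ∀ w ∈ 𝔞, J w ∈ 𝔞)
    (hab : ∀ w ∈ 𝔞, ∀ u ∈ 𝔞, br w u = 0) (hid : ∀ x, ∀ w ∈ 𝔞, br x w ∈ 𝔞)
    (hdim : Module.finrank ℝ 𝔞 + 2 = Module.finrank ℝ V)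
    (hu : ∀ x, LinearMap.trace ℝ V (br x) = 0) {α β C : ℝ}
    (hmix : ∀ x, α * (-LinearMap.trace ℝ V (bottFamily J br (bottFamily J br x x))) * ‖x‖ ^ 2 +
      β * quarticForm (bottFamily J br) x = C * ‖x‖ ^ 4) :
    C = 0 ∧ (β ≠ 0 → ∀ x y, chernCurvature J br x y = 0) := by
  obtain ⟨e, b, v, hF⟩ := h.exists_isCodimTwoFamily haJ hab hid hdim
  set c := stdOrthonormalBasis ℝ 𝔞
  have htr := h.trace_right_sq hab hid hu hF c
  by_cases hβ : β = 0
  · refine ⟨?_, fun h0 => absurd hβ h0⟩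
    subst hβ
    -- For `β = 0` a nonzero `w ∈ 𝔞` gives `C = 0` through the coefficient of `s⁴`; if `𝔞 = 0`, the
    -- trace identity reads `0 = 2 b²` and the Ricci term vanishes.
    by_cases h𝔞 : 𝔞 = ⊥
    · have hsum : ∀ f : V → ℝ, ∑ j, f (c j : V) = ∑ j : Fin (Module.finrank ℝ 𝔞), f 0 := by
        intro f
        refine Finset.sum_congr rfl fun j _ => ?_
        rw [(Submodule.eq_bot_iff 𝔞).1 h𝔞 _ (c j).2]
      have hb : b = 0 := by
        rw [hsum (fun w => ⟪w, bottFamily J br (bottFamily J br w e) e⟫),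
          hsum (fun w => ⟪w, bottFamily J br e w⟫)] at htr
        simp at htr
        simpa using htr
      have := (hF.mixed_coeff c hmix rfl 𝔞.zero_mem).1
      rw [hb] at this
      simp at this
      exact this.symm
    · obtain ⟨w, hw, hw0⟩ := Submodule.exists_mem_ne_zero_of_ne_bot h𝔞
      have := (hF.mixed_coeff c hmix rfl hw).2.2.2
      rw [zero_mul] at this
      exact (mul_eq_zero.1 this.symm).resolve_right (pow_ne_zero _ (norm_ne_zero_iff.2 hw0))
  · obtain ⟨hC, hee, hLw, hn⟩ := hF.rigid c htr hmix hβ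
    refine ⟨hC, fun _ => h.chernCurvature_eq_zero (fun x y => hLw _ ?_) hn⟩
    have heJ : br e (J e) = 0 := by
      have := h.bottFamily_self e
      rw [hee] at this
      have := congrArg J this
      rw [map_neg, h.J_J, neg_neg, map_zero] at this
      exact this.symm
    have hdec : ∀ x, x = 𝔞.starProjection x + ⟪x, e⟫ • e + ⟪x, J e⟫ • J e := by
      intro x
      rw [hF.starProjection_eq]; abel
    have hmemr : ∀ x, ∀ w ∈ 𝔞, br w x ∈ 𝔞 := fun x w hw => by
      rw [h.swap]
      exact 𝔞.neg_mem (hid x w hw)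
    have hx := Submodule.starProjection_apply_mem 𝔞 x
    have hy := Submodule.starProjection_apply_mem 𝔞 y
    rw [hdec x, hdec y]
    simp only [map_add, map_smul, LinearMap.add_apply, LinearMap.smul_apply, h.self, heJ,
      h.swap (J e) e, neg_zero, smul_zero, add_zero]
    exact 𝔞.add_mem (𝔞.add_mem (𝔞.add_mem (𝔞.add_mem (hid _ _ hy) (𝔞.smul_mem _ (hid _ _ hy)))
      (𝔞.smul_mem _ (hid _ _ hy))) (𝔞.smul_mem _ (hmemr _ _ hx))) (𝔞.smul_mem _ (hmemr _ _ hx))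

end IsHermitianBracket

end CodimTwoBracket

/-! ## Solvable Lie algebras: the commutator acts nilpotently -/

section Solvable

open scoped TensorProduct

universe u

namespace LieModule

/-- The vectors annihilated by an ideal. -/
def annihilatedBy {K L M : Type*} [CommRing K] [LieRing L] [LieAlgebra K L] [AddCommGroup M]
    [Module K M] [LieRingModule L M] [LieModule K L M] (I : LieIdeal K L) : LieSubmodule K L M where
  carrier := {m | ∀ x ∈ I, ⁅x, m⁆ = 0}
  add_mem' ha hb x hx := by rw [lie_add, ha x hx, hb x hx, add_zero]
  zero_mem' x _ := lie_zero x
  smul_mem' c m hm x hx := by rw [lie_smul, hm x hx, smul_zero]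
  lie_mem {y m} hm x hx := by
    rw [leibniz_lie, hm x hx, lie_zero, add_zero]
    exact hm _ (lie_mem_left K L I x y hx)

variable {K L : Type*} [Field K] [CharZero K] [LieRing L] [LieAlgebra K L]

/-- By Lie's theorem there is a common eigenvector. Its weight kills commutators, so the submodule
annihilated by the derived ideal is nonzero, and induction applies to the quotient. -/
lemma isNilpotent_toEnd_of_mem_derivedSeries_of_isAlgClosed [IsAlgClosed K]
    [LieAlgebra.IsSolvable L] (d : ℕ) :
    ∀ (M : Type u) [AddCommGroup M] [Module K M] [LieRingModule L M] [LieModule K L M]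
      [FiniteDimensional K M], Module.finrank K M ≤ d →
      ∀ x ∈ LieAlgebra.derivedSeries K L 1, _root_.IsNilpotent (toEnd K L M x) := by
  induction d with
  | zero =>
    intro M _ _ _ _ _ hd x _
    have : Subsingleton M := Module.finrank_zero_iff.1 (Nat.le_zero.1 hd)
    exact ⟨1, LinearMap.ext fun m => Subsingleton.elim _ _⟩
  | succ d ih =>
    intro M _ _ _ _ _ hd x hx
    obtain _ | _ := subsingleton_or_nontrivial M
    · exact ⟨1, LinearMap.ext fun m => Subsingleton.elim _ _⟩
    obtain ⟨χ, hχ⟩ := exists_nontrivial_weightSpace_of_isSolvable K L M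
    obtain ⟨⟨v, hv⟩, hv0⟩ := exists_ne (0 : weightSpace M χ)
    rw [mem_weightSpace] at hv
    let W : LieSubmodule K L M := annihilatedBy (LieAlgebra.derivedSeries K L 1)
    have hvW : v ∈ W := by
      intro y hy
      have hle : (LieAlgebra.derivedSeries K L 1).toSubmodule ≤ LinearMap.ker χ := by
        have : LieAlgebra.derivedSeries K L 1 = ⁅(⊤ : LieIdeal K L), (⊤ : LieIdeal K L)⁆ := rfl
        rw [this, LieSubmodule.lieIdeal_oper_eq_linear_span', Submodule.span_le]
        rintro _ ⟨a, -, b, -, rfl⟩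
        have hab : χ ⁅a, b⁆ • v = 0 := by
          rw [← hv, lie_lie, hv a, hv b, lie_smul, lie_smul, hv a, hv b, smul_smul, smul_smul,
            mul_comm, sub_self]
        exact (smul_eq_zero.1 hab).resolve_right fun h0 => hv0 (Subtype.ext h0)
      rw [hv, LinearMap.mem_ker.1 (hle hy), zero_smul]
    have hlt : Module.finrank K (M ⧸ W) ≤ d := by
      have h1 := Submodule.finrank_quotient_add_finrank W.toSubmodule
      have h2 : 0 < Module.finrank K W.toSubmodule := by
        have : Nontrivial W.toSubmodule :=
          nontrivial_of_ne ⟨v, hvW⟩ 0 fun h0 =>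
            hv0 (Subtype.ext (show v = 0 from congrArg Subtype.val h0))
        exact Module.finrank_pos
      change Module.finrank K (M ⧸ W.toSubmodule) ≤ d
      omega
    obtain ⟨k, hk⟩ := ih (M ⧸ W) hlt x hx
    refine ⟨k + 1, LinearMap.ext fun m => ?_⟩
    have hmem : ((toEnd K L M x) ^ k) m ∈ W := by
      rw [← LieSubmodule.Quotient.mk_eq_zero]
      have : ∀ j, LieSubmodule.Quotient.mk' W (((toEnd K L M x) ^ j) m) =
          ((toEnd K L (M ⧸ W) x) ^ j) (LieSubmodule.Quotient.mk' W m) := by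
        intro j
        induction j with
        | zero => rfl
        | succ j hj =>
          rw [pow_succ', pow_succ', Module.End.mul_apply, Module.End.mul_apply, ← hj]
          rfl
      rw [this, hk]
      rfl
    rw [pow_succ', Module.End.mul_apply]
    exact hmem x hx

/-- Over a field of characteristic zero, the commutator of a solvable Lie algebra acts nilpotently
on every finite-dimensional module. -/
theorem isNilpotent_derivedSeries_of_isSolvable [LieAlgebra.IsSolvable L]
    (M : Type*) [AddCommGroup M] [Module K M] [LieRingModule L M] [LieModule K L M]
    [FiniteDimensional K M] : IsNilpotent (LieAlgebra.derivedSeries K L 1) M := by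
  -- Engel's theorem reduces to single operators, whose nilpotency may be tested over the algebraic
  -- closure.
  rw [isNilpotent_iff_forall' (R := K)]
  intro ⟨x, hx⟩
  set A := AlgebraicClosure K
  have hx_ext : 1 ⊗ₜ[K] x ∈ LieAlgebra.derivedSeries A (A ⊗[K] L) 1 := by
    rw [LieAlgebra.derivedSeries_baseChange]
    exact Submodule.tmul_mem_baseChange_of_mem 1 hx
  have aux : (toEnd K (LieAlgebra.derivedSeries K L 1) M ⟨x, hx⟩).baseChangeHom K A M =
      (toEnd K L M x).baseChange A := rfl
  have hinj : Function.Injective (Module.End.baseChangeHom K A M) :=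
    LinearMap.baseChangeHom_injective K M A
  rw [← IsNilpotent.map_iff hinj, aux, ← toEnd_baseChange]
  exact isNilpotent_toEnd_of_mem_derivedSeries_of_isAlgClosed _ (A ⊗[K] M) le_rfl _ hx_ext

end LieModule

end Solvable

/-! ## Hermitian brackets with a nilpotent filtration -/

section NilpotentBracket

/-- `N` is a proper complex subspace that contains all brackets, and the operators `[n, ·]`,
`n ∈ N`, shift a finite filtration `Λ`. -/
structure IsBracketFiltration {V : Type*} [AddCommGroup V] [Module ℝ V] (J : V →ₗ[ℝ] V)
    (br : V →ₗ[ℝ] V →ₗ[ℝ] V) (N : Submodule ℝ V) (Λ : ℕ → Submodule ℝ V) : Prop where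
  ne_top : N ≠ ⊤
  J_mem : ∀ n ∈ N, J n ∈ N
  bracket_mem : ∀ x y, br x y ∈ N
  zero_eq_top : Λ 0 = ⊤
  shift : ∀ k, ∀ n ∈ N, ∀ y ∈ Λ k, br n y ∈ Λ (k + 1)
  eventually_bot : ∃ k, Λ k = ⊥

variable {V : Type*} [NormedAddCommGroup V] [InnerProductSpace ℝ V]
  {J : V →ₗ[ℝ] V} {br : V →ₗ[ℝ] V →ₗ[ℝ] V} {N : Submodule ℝ V} {Λ : ℕ → Submodule ℝ V}

lemma IsHermitianBracket.isNilpotentFiltration (h : IsHermitianBracket J br)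
    (hΛ : IsBracketFiltration J br N Λ) :
    IsNilpotentFiltration (bottFamily J br) N (fun k => Λ k ⊔ (Λ k).map J) where
  le_zero := by
    rw [hΛ.zero_eq_top, top_sup_eq]
    exact le_top
  shift k n hn y hy := by
    have hmem : ∀ a ∈ Λ k, bottFamily J br n a ∈ Λ (k + 1) ⊔ (Λ (k + 1)).map J := fun a ha =>
      Submodule.add_mem_sup (hΛ.shift k n hn a ha)
        (Submodule.mem_map_of_mem (hΛ.shift k _ (hΛ.J_mem n hn) a ha))
    have hJ : ∀ z ∈ Λ (k + 1) ⊔ (Λ (k + 1)).map J, J z ∈ Λ (k + 1) ⊔ (Λ (k + 1)).map J := by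
      intro z hz
      obtain ⟨a, ha, _, ⟨b, hb, rfl⟩, rfl⟩ := Submodule.mem_sup.1 hz
      rw [map_add, h.J_J, add_comm (J a)]
      exact Submodule.add_mem_sup (Submodule.neg_mem _ hb) (Submodule.mem_map_of_mem ha)
    obtain ⟨a, ha, _, ⟨b, hb, rfl⟩, rfl⟩ := Submodule.mem_sup.1 hy
    rw [map_add, h.isAntilinearFamily.map_J]
    exact Submodule.add_mem _ (hmem a ha) (hJ _ (hmem b hb))
  eventually_bot := by
    obtain ⟨k, hk⟩ := hΛ.eventually_bot
    exact ⟨k, by rw [hk, Submodule.map_bot, sup_bot_eq]⟩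

/-- All values of `L` lie in `N`, where `L n` is nilpotent; the Ricci term therefore vanishes and
only `β q` remains. -/
theorem IsHermitianBracket.filtration_rigid [FiniteDimensional ℝ V] (h : IsHermitianBracket J br)
    (hΛ : IsBracketFiltration J br N Λ) {α β C : ℝ}
    (hmix : ∀ x, α * (-LinearMap.trace ℝ V (bottFamily J br (bottFamily J br x x))) * ‖x‖ ^ 2 +
      β * quarticForm (bottFamily J br) x = C * ‖x‖ ^ 4) :
    C = 0 ∧ (β ≠ 0 → ∀ x y, chernCurvature J br x y = 0) := by
  have hF := h.isNilpotentFiltration hΛ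
  have hLN : ∀ x y, bottFamily J br x y ∈ N := fun x y =>
    N.add_mem (hΛ.bracket_mem x y) (hΛ.J_mem _ (hΛ.bracket_mem _ y))
  have htr : ∀ x, LinearMap.trace ℝ V (bottFamily J br (bottFamily J br x x)) = 0 := fun x =>
    (LinearMap.isNilpotent_trace_of_isNilpotent (hF.isNilpotent hLN (hLN x x))).eq_zero
  have hmix' : ∀ x, β * quarticForm (bottFamily J br) x = C * ‖x‖ ^ 4 := by
    intro x
    rw [← hmix x, htr]
    ring
  by_cases hβ : β = 0
  · refine ⟨?_, fun h0 => absurd hβ h0⟩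
    obtain ⟨x, -, hx⟩ := SetLike.exists_of_lt (lt_top_iff_ne_top.2 hΛ.ne_top)
    have hx0 : x ≠ 0 := fun h0 => hx (h0 ▸ N.zero_mem)
    have := hmix' x
    rw [hβ, zero_mul] at this
    exact (mul_eq_zero.1 this.symm).resolve_right (pow_ne_zero _ (norm_ne_zero_iff.2 hx0))
  · obtain ⟨hk, hN, hn⟩ := h.isAntilinearFamily.normal_of_nilpotent (k := C / β) hF hΛ.ne_top
      hΛ.J_mem hLN (fun x y => ⟨_, N.sub_mem (hΛ.bracket_mem x y) (hΛ.bracket_mem (J x) (J y)),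
        h.bottFamily_comm x y⟩) (fun x => by rw [div_mul_eq_mul_div, ← hmix' x]; field_simp)
    refine ⟨(div_eq_zero_iff.1 hk).resolve_right hβ, fun _ => ?_⟩
    exact h.chernCurvature_eq_zero (fun x y => hN _ (hΛ.bracket_mem x y)) hn

end NilpotentBracket

/-! ## Hermitian Lie algebras with constant mixed curvature -/

section HermitianLieAlgebra

variable {𝔤 : Type*} [LieRing 𝔤] [LieAlgebra ℝ 𝔤]

/-- The Lie bracket as a bilinear map. -/
def lieBracketBilin (𝔤 : Type*) [LieRing 𝔤] [LieAlgebra ℝ 𝔤] : 𝔤 →ₗ[ℝ] 𝔤 →ₗ[ℝ] 𝔤 :=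
  (LieAlgebra.ad ℝ 𝔤 : 𝔤 →ₗ[ℝ] 𝔤 →ₗ[ℝ] 𝔤)

lemma lie_mem_commutatorIdeal (x y : 𝔤) : ⁅x, y⁆ ∈ commutatorIdeal 𝔤 :=
  LieSubmodule.lie_mem_lie (LieSubmodule.mem_top x) (LieSubmodule.mem_top y)

namespace HermitianStructure

variable (h : HermitianStructure 𝔤)

lemma lie_J_J (x y : 𝔤) : ⁅h.J x, h.J y⁆ = ⁅x, y⁆ + h.J (⁅h.J x, y⁆ + ⁅x, h.J y⁆) := by
  have := h.integrable x y
  rw [map_add, ← sub_eq_zero, ← neg_eq_zero, ← this]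
  abel

lemma J_mem_sup_map {S : Submodule ℝ 𝔤} {z : 𝔤} (hz : z ∈ S ⊔ S.map h.J) :
    h.J z ∈ S ⊔ S.map h.J := by
  obtain ⟨a, ha, _, ⟨b, hb, rfl⟩, rfl⟩ := Submodule.mem_sup.1 hz
  rw [map_add, h.J_J, add_comm (h.J a)]
  exact Submodule.add_mem_sup (Submodule.neg_mem _ hb) (Submodule.mem_map_of_mem ha)

/-- If `𝔤' + J 𝔤'` were everything, the same would hold with every term of the lower central series
in place of `𝔤'`: integrability rewrites `[J b, J d]` through brackets having an entry in the
preceding term. Nilpotency excludes this. -/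
lemma commutator_sup_map_ne_top [Nontrivial 𝔤] [LieRing.IsNilpotent 𝔤] :
    (commutatorIdeal 𝔤).toSubmodule ⊔ (commutatorIdeal 𝔤).toSubmodule.map h.J ≠ ⊤ := by
  intro htop
  have hall : ∀ k, (LieModule.lowerCentralSeries ℝ 𝔤 𝔤 k).toSubmodule ⊔
      (LieModule.lowerCentralSeries ℝ 𝔤 𝔤 k).toSubmodule.map h.J = ⊤ := by
    intro k
    induction k with
    | zero => simp
    | succ k ih =>
      set S := LieModule.lowerCentralSeries ℝ 𝔤 𝔤 (k + 1) with hS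
      have hlie : ∀ x : 𝔤, ∀ y ∈ LieModule.lowerCentralSeries ℝ 𝔤 𝔤 k, ⁅x, y⁆ ∈ S := by
        intro x y hy
        rw [hS, LieModule.lowerCentralSeries_succ]
        exact LieSubmodule.lie_mem_lie (LieSubmodule.mem_top x) hy
      have hlie' : ∀ x : 𝔤, ∀ y ∈ LieModule.lowerCentralSeries ℝ 𝔤 𝔤 k, ⁅y, x⁆ ∈ S := by
        intro x y hy
        rw [← lie_skew]
        exact S.neg_mem (hlie x y hy)
      have hcomm : (commutatorIdeal 𝔤).toSubmodule ≤ S.toSubmodule ⊔ S.toSubmodule.map h.J := by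
        rw [commutatorIdeal, LieSubmodule.lieIdeal_oper_eq_linear_span', Submodule.span_le]
        rintro _ ⟨x, -, y, -, rfl⟩
        obtain ⟨a, ha, _, ⟨b, hb, rfl⟩, rfl⟩ := Submodule.mem_sup.1 (ih ▸ Submodule.mem_top : x ∈ _)
        obtain ⟨c, hc, _, ⟨d, hd, rfl⟩, rfl⟩ := Submodule.mem_sup.1 (ih ▸ Submodule.mem_top : y ∈ _)
        rw [add_lie, lie_add, lie_add, h.lie_J_J]
        refine Submodule.add_mem _ (Submodule.mem_sup_left (S.add_mem (hlie _ _ hc) (hlie' _ _ ha)))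
          (Submodule.add_mem _ (Submodule.mem_sup_left (hlie _ _ hc)) (Submodule.add_mem_sup
            (hlie _ _ hd) (Submodule.mem_map_of_mem (S.add_mem (hlie _ _ hd) (hlie' _ _ hb)))))
      rw [eq_top_iff, ← htop, sup_le_iff]
      refine ⟨hcomm, ?_⟩
      rintro _ ⟨z, hz, rfl⟩
      exact h.J_mem_sup_map (hcomm hz)
  obtain ⟨k, hk⟩ := (LieModule.isNilpotent_iff ℝ 𝔤 𝔤).1 ‹LieRing.IsNilpotent 𝔤›
  have := hall k
  rw [hk, LieSubmodule.bot_toSubmodule, Submodule.map_bot, sup_bot_eq] at this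
  exact bot_ne_top this

lemma exists_isBracketFiltration_of_isNilpotent [Nontrivial 𝔤] [LieRing.IsNilpotent 𝔤] :
    ∃ N Λ, IsBracketFiltration h.J (lieBracketBilin 𝔤) N Λ := by
  obtain ⟨k, hk⟩ := (LieModule.isNilpotent_iff ℝ 𝔤 𝔤).1 ‹LieRing.IsNilpotent 𝔤›
  refine ⟨_, fun k => (LieModule.lowerCentralSeries ℝ 𝔤 𝔤 k).toSubmodule,
    h.commutator_sup_map_ne_top, fun n hn => h.J_mem_sup_map hn,
    fun x y => Submodule.mem_sup_left (lie_mem_commutatorIdeal x y), by simp, ?_,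
    k, by simp only [hk, LieSubmodule.bot_toSubmodule]⟩
  intro k n _ y hy
  rw [LieModule.lowerCentralSeries_succ]
  exact LieSubmodule.lie_mem_lie (LieSubmodule.mem_top n) hy

lemma exists_isBracketFiltration_of_isSolvable [Nontrivial 𝔤] [FiniteDimensional ℝ 𝔤]
    [LieAlgebra.IsSolvable 𝔤] (hJ : h.HasComplexCommutator) :
    ∃ N Λ, IsBracketFiltration h.J (lieBracketBilin 𝔤) N Λ := by
  have hnil : LieModule.IsNilpotent (commutatorIdeal 𝔤) 𝔤 :=
    LieModule.isNilpotent_derivedSeries_of_isSolvable (K := ℝ) 𝔤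
  obtain ⟨k, hk⟩ := (LieModule.isNilpotent_iff ℝ (commutatorIdeal 𝔤) 𝔤).1 hnil
  refine ⟨(commutatorIdeal 𝔤).toSubmodule,
    fun k => (LieModule.lowerCentralSeries ℝ (commutatorIdeal 𝔤) 𝔤 k).toSubmodule, ?_, ?_,
    lie_mem_commutatorIdeal, by simp, ?_, k, by simp only [hk, LieSubmodule.bot_toSubmodule]⟩
  · intro htop
    exact (LieAlgebra.derivedSeries_lt_top_of_solvable ℝ 𝔤).ne
      ((LieSubmodule.toSubmodule_eq_top _).1 htop)
  · intro n hn
    rw [← hJ]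
    exact Submodule.mem_map_of_mem hn
  · intro k n hn y hy
    rw [LieModule.lowerCentralSeries_succ]
    exact LieSubmodule.lie_mem_lie (LieSubmodule.mem_top (⟨n, hn⟩ : commutatorIdeal 𝔤)) hy

/-- `𝔞` is an abelian ideal of codimension two which is invariant under `J`. -/
structure IsComplexAbelianIdeal (𝔞 : Submodule ℝ 𝔤) : Prop where
  J_mem : ∀ w ∈ 𝔞, h.J w ∈ 𝔞
  lie_eq_zero : ∀ w ∈ 𝔞, ∀ u ∈ 𝔞, ⁅w, u⁆ = 0
  lie_mem : ∀ x : 𝔤, ∀ w ∈ 𝔞, ⁅x, w⁆ ∈ 𝔞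
  finrank_add_two : Module.finrank ℝ 𝔞 + 2 = Module.finrank ℝ 𝔤

variable {h} in
lemma HasComplexAbelianIdealOfCodimTwo.exists_isComplexAbelianIdeal
    (hc : h.HasComplexAbelianIdealOfCodimTwo) : ∃ 𝔞, h.IsComplexAbelianIdeal 𝔞 := by
  obtain ⟨𝔞, hab, hdim, hJ⟩ := hc
  refine ⟨𝔞.toSubmodule, fun w hw => hJ ▸ Submodule.mem_map_of_mem hw, fun w hw u hu => ?_,
    fun x w hw => 𝔞.lie_mem hw, hdim⟩
  exact congrArg Subtype.val (hab.trivial ⟨w, hw⟩ ⟨u, hu⟩)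

/-- The ideal is `𝔞 ∩ J 𝔞`. -/
lemma exists_isComplexAbelianIdeal_of_isAlmostAbelian [FiniteDimensional ℝ 𝔤]
    (ha : IsAlmostAbelian 𝔤) : ∃ 𝔟, h.IsComplexAbelianIdeal 𝔟 := by
  obtain ⟨𝔞, hab, hdim⟩ := ha
  replace hab : ∀ w ∈ 𝔞, ∀ u ∈ 𝔞, ⁅w, u⁆ = 0 := fun w hw u hu =>
    congrArg Subtype.val (hab.trivial ⟨w, hw⟩ ⟨u, hu⟩)
  have hinj : Function.Injective h.J := fun x y hxy => by
    have := congrArg h.J hxy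
    rwa [h.J_J, h.J_J, neg_inj] at this
  set S := 𝔞.toSubmodule with hS
  replace hdim : Module.finrank ℝ S + 1 = Module.finrank ℝ 𝔤 := hdim
  have hmapdim : Module.finrank ℝ (S.map h.J) = Module.finrank ℝ S :=
    (Submodule.equivMapOfInjective h.J hinj S).finrank_eq.symm
  have hcoatom : ∀ T : Submodule ℝ 𝔤, S < T → T = ⊤ := by
    intro T hT
    apply Submodule.eq_top_of_finrank_eq
    have h1 := Submodule.finrank_lt_finrank_of_lt hT
    have h2 := Submodule.finrank_le T
    omega
  -- A hyperplane is never `J`-invariant: `J` would act on the quotient line by a real `t` with `t²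
  -- = -1`.
  have htop : S ⊔ S.map h.J = ⊤ := by
    by_contra hne
    have hle : S.map h.J ≤ S := by
      by_contra hle
      exact hne (hcoatom _ (left_lt_sup.2 hle))
    have hJS : ∀ w ∈ S, h.J w ∈ S := fun w hw => hle (Submodule.mem_map_of_mem hw)
    obtain ⟨x, hx⟩ : ∃ x, x ∉ S := by
      by_contra! hall
      rw [(Submodule.eq_top_iff').2 hall, finrank_top] at hdim
      omega
    have hspan : S ⊔ Submodule.span ℝ {x} = ⊤ := by
      apply hcoatom
      rw [left_lt_sup]
      exact fun hle => hx (hle (Submodule.mem_span_singleton_self x))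
    obtain ⟨a, ha, _, hb, hab⟩ := Submodule.mem_sup.1 (hspan ▸ Submodule.mem_top : h.J x ∈ _)
    obtain ⟨t, rfl⟩ := Submodule.mem_span_singleton.1 hb
    have h2 := congrArg h.J hab
    rw [map_add, map_smul, h.J_J, ← hab] at h2
    have h3 : (1 + t ^ 2) • x = -(h.J a + t • a) := by
      linear_combination (norm := module) h2
    have h4 : (1 + t ^ 2) • x ∈ S := h3 ▸ S.neg_mem (S.add_mem (hJS a ha) (S.smul_mem t ha))
    exact hx ((S.smul_mem_iff (by positivity)).1 h4)
  have hJS : ∀ w ∈ S ⊓ S.map h.J, h.J w ∈ S := by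
    rintro _ ⟨-, ⟨b, hb, rfl⟩⟩
    rw [h.J_J]
    exact S.neg_mem hb
  have hmem : ∀ w, w ∈ S → h.J w ∈ S → w ∈ S ⊓ S.map h.J := fun w hw hJw =>
    ⟨hw, ⟨-h.J w, S.neg_mem hJw, by rw [map_neg, h.J_J, neg_neg]⟩⟩
  refine ⟨S ⊓ S.map h.J, fun w hw => hmem _ (hJS w hw) ?_, fun w hw u hu => hab w hw.1 u hu.1,
    fun x w hw => hmem _ (𝔞.lie_mem hw.1) ?_, ?_⟩
  · rw [h.J_J]
    exact S.neg_mem hw.1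
  · obtain ⟨a, ha, _, ⟨b, hb, rfl⟩, rfl⟩ := Submodule.mem_sup.1 (htop ▸ Submodule.mem_top : x ∈ _)
    -- With `b`, `w`, `J w` in `𝔞`, integrability becomes `[J b, J w] = J [J b, w]`, so `J [J b, w]`
    -- stays in `𝔞`.
    have := h.lie_J_J b w
    rw [hab b hb w hw.1, hab b hb _ (hJS w hw), zero_add, add_zero] at this
    rw [add_lie, hab a ha w hw.1, zero_add, ← this]
    exact 𝔞.lie_mem (hJS w hw)
  · have := Submodule.finrank_sup_add_finrank_inf_eq S (S.map h.J)
    rw [htop, finrank_top] at this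
    omega

end HermitianStructure

end HermitianLieAlgebra

/-! ### The algebraic form of the theorem -/

section ConstantMixedCurvature

theorem IsHermitianBracket.rigid {V : Type*} [NormedAddCommGroup V] [InnerProductSpace ℝ V]
    [FiniteDimensional ℝ V] {J : V →ₗ[ℝ] V} {br : V →ₗ[ℝ] V →ₗ[ℝ] V}
    (h : IsHermitianBracket J br) {n : ℕ} (hn0 : 0 < n) (hn : Module.finrank ℝ V = 2 * n)
    (hcases : (∃ N Λ, IsBracketFiltration J br N Λ) ∨
      (∀ x, LinearMap.trace ℝ V (br x) = 0) ∧ ∃ 𝔞 : Submodule ℝ V, (∀ w ∈ 𝔞, J w ∈ 𝔞) ∧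
        (∀ w ∈ 𝔞, ∀ u ∈ 𝔞, br w u = 0) ∧ (∀ x, ∀ w ∈ 𝔞, br x w ∈ 𝔞) ∧
        Module.finrank ℝ 𝔞 + 2 = Module.finrank ℝ V) {α β c : ℝ}
    (hc : ∀ u : Fin n → V, IsRealUnitaryFrame J u → ∀ x : V, ⟪x, x⟫ = 1 / 2 →
      α * (-4 * ∑ i, ⟪chernCurvature J br x (J x) (u i), J (u i)⟫) +
        β * (-4 * ⟪chernCurvature J br x (J x) x, J x⟫) = c) :
    c = 0 ∧ (β ≠ 0 → ∀ x y, chernCurvature J br x y = 0) := by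
  have hmix := h.mixedCurvature_homogeneous hn0 hn hc
  have key : 2 * c = 0 ∧ (β ≠ 0 → ∀ x y, chernCurvature J br x y = 0) := by
    rcases hcases with ⟨N, Λ, hΛ⟩ | ⟨hu, 𝔞, haJ, hab, hid, hdim⟩
    · exact h.filtration_rigid hΛ hmix
    · exact h.codimTwo_rigid haJ hab hid hdim hu hmix
  exact ⟨by linarith [key.1], key.2⟩

variable {𝔤 : Type*} [LieRing 𝔤] [LieAlgebra ℝ 𝔤]

namespace HermitianStructure

/-- The operation `y ↦ ∇_x y` on left-invariant vector fields is the one of the Chern connection: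
`2 g(∇_x y, z) = g([x, y] + J [J x, y], z) - g(y, [x, z] + J [J x, z])`. -/
def IsChernOperation (h : HermitianStructure 𝔤) (Γ : 𝔤 → 𝔤 → 𝔤) : Prop :=
  ∀ x y z, 2 * h.metric (Γ x y) z =
    h.metric (⁅x, y⁆ + h.J ⁅h.J x, y⁆) z - h.metric y (⁅x, z⁆ + h.J ⁅h.J x, z⁆)

/-- The curvature of an operation `(x, y) ↦ ∇_x y` on a Lie algebra. -/
def operationCurvature (Γ : 𝔤 → 𝔤 → 𝔤) (x y z : 𝔤) : 𝔤 :=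
  Γ x (Γ y z) - Γ y (Γ x z) - Γ ⁅x, y⁆ z

/-- The inner product space structure defined by the metric. -/
@[reducible]
def innerCore (h : HermitianStructure 𝔤) : InnerProductSpace.Core ℝ 𝔤 where
  inner x y := h.metric x y
  conj_inner_symm x y := h.metric_symm y x
  re_inner_nonneg x := by
    by_cases hx : x = 0
    · simp [hx]
    · exact (h.metric_pos x hx).le
  add_left x y z := by simp
  smul_left x y r := by simp
  definite x hx := by
    by_contra h0
    exact (h.metric_pos x h0).ne' hx

theorem rigid [FiniteDimensional ℝ 𝔤] (h : HermitianStructure 𝔤) {n : ℕ} (hn0 : 0 < n)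
    (hn : Module.finrank ℝ 𝔤 = 2 * n)
    (hcases : LieRing.IsNilpotent 𝔤 ∨ (LieAlgebra.IsSolvable 𝔤 ∧ h.HasComplexCommutator) ∨
      (IsUnimodularLieAlgebra 𝔤 ∧ IsAlmostAbelian 𝔤) ∨
      (IsUnimodularLieAlgebra 𝔤 ∧ h.HasComplexAbelianIdealOfCodimTwo))
    {Γ : 𝔤 → 𝔤 → 𝔤} (hΓ : h.IsChernOperation Γ) {α β c : ℝ}
    (hc : ∀ u : Fin n → 𝔤, (∀ i j, h.metric (u i) (u j) = if i = j then 1 / 2 else 0) →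
      (∀ i j, h.metric (u i) (h.J (u j)) = 0) → ∀ x, h.metric x x = 1 / 2 →
      α * (-4 * ∑ i, h.metric (operationCurvature Γ x (h.J x) (u i)) (h.J (u i))) +
        β * (-4 * h.metric (operationCurvature Γ x (h.J x) x) (h.J x)) = c) :
    c = 0 ∧ (β ≠ 0 → ∀ x y z, operationCurvature Γ x y z = 0) := by
  have : Nontrivial 𝔤 := Module.nontrivial_of_finrank_pos (R := ℝ) (by omega)
  have hcases' : (∃ N Λ, IsBracketFiltration h.J (lieBracketBilin 𝔤) N Λ) ∨
      (∀ x, LinearMap.trace ℝ 𝔤 (lieBracketBilin 𝔤 x) = 0) ∧ ∃ 𝔞 : Submodule ℝ 𝔤,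
        (∀ w ∈ 𝔞, h.J w ∈ 𝔞) ∧ (∀ w ∈ 𝔞, ∀ u ∈ 𝔞, lieBracketBilin 𝔤 w u = 0) ∧
        (∀ x, ∀ w ∈ 𝔞, lieBracketBilin 𝔤 x w ∈ 𝔞) ∧
        Module.finrank ℝ 𝔞 + 2 = Module.finrank ℝ 𝔤 := by
    rcases hcases with hnil | ⟨hs, hJ⟩ | ⟨hu, ha⟩ | ⟨hu, ha⟩
    · exact .inl h.exists_isBracketFiltration_of_isNilpotent
    · exact .inl (h.exists_isBracketFiltration_of_isSolvable hJ)
    · obtain ⟨𝔞, ha⟩ := h.exists_isComplexAbelianIdeal_of_isAlmostAbelian ha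
      exact .inr ⟨hu, 𝔞, ha.J_mem, ha.lie_eq_zero, ha.lie_mem, ha.finrank_add_two⟩
    · obtain ⟨𝔞, ha⟩ := ha.exists_isComplexAbelianIdeal
      exact .inr ⟨hu, 𝔞, ha.J_mem, ha.lie_eq_zero, ha.lie_mem, ha.finrank_add_two⟩
  let : NormedAddCommGroup 𝔤 := h.innerCore.toNormedAddCommGroup
  let : InnerProductSpace ℝ 𝔤 := InnerProductSpace.ofCore h.innerCore.toCore
  have hH : IsHermitianBracket h.J (lieBracketBilin 𝔤) :=
    ⟨h.J_J, h.metric_J, lie_self, leibniz_lie, h.integrable⟩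
  have hΓ' : ∀ x y, Γ x y = chernFamily h.J (lieBracketBilin 𝔤) x y := by
    intro x y
    refine ext_inner_right ℝ fun z => ?_
    rw [chernFamily_apply, real_inner_smul_left, inner_sub_left, inner_adjointFamily_left]
    have := hΓ x y z
    change h.metric (Γ x y) z = 1 / 2 * (h.metric (⁅x, y⁆ + h.J ⁅h.J x, y⁆) z -
      h.metric y (⁅x, z⁆ + h.J ⁅h.J x, z⁆))
    linarith
  have hR : ∀ x y z, operationCurvature Γ x y z =
      chernCurvature h.J (lieBracketBilin 𝔤) x y z := by
    intro x y z
    rw [operationCurvature, chernCurvature_apply, hΓ', hΓ', hΓ', hΓ', hΓ']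
    rfl
  have key := hH.rigid hn0 hn hcases' (α := α) (β := β) (c := c) (by
    intro u hu x hx
    have := hc u hu.1 hu.2 x hx
    simp only [hR] at this
    exact this)
  refine ⟨key.1, fun hβ x y z => ?_⟩
  rw [hR, key.2 hβ]
  rfl

end HermitianStructure

end ConstantMixedCurvature

/-! ## The Chern connection on left-invariant vector fields -/

section ChernOperation

variable {𝔤 : Type*} [LieRing 𝔤] [LieAlgebra ℝ 𝔤] (h : HermitianStructure 𝔤)

namespace HermitianStructure

lemma metric_ext {x y : 𝔤} (hxy : ∀ z, h.metric x z = h.metric y z) : x = y := by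
  by_contra hne
  have := h.metric_pos (x - y) (sub_ne_zero.2 hne)
  have h0 : h.metric (x - y) (x - y) = h.metric x (x - y) - h.metric y (x - y) := by
    rw [← LinearMap.sub_apply, ← map_sub]
  rw [h0, hxy, sub_self] at this
  exact this.false

lemma metric_J_left (x y : 𝔤) : h.metric (h.J x) y = -h.metric x (h.J y) := by
  rw [← h.metric_J x (h.J y), h.J_J, map_neg, neg_neg]

variable {h} {Γ Γ' : 𝔤 → 𝔤 → 𝔤}

lemma IsChernOperation.eq (hΓ : h.IsChernOperation Γ) (hΓ' : h.IsChernOperation Γ') : Γ = Γ' := by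
  funext x y
  refine h.metric_ext fun z => ?_
  have h1 := hΓ x y z
  have h2 := hΓ' x y z
  linarith

/-- The torsion condition amounts to `Γ x + J Γ (J x) = L x`. Here `Γ x` is skew, while `J Γ (J x)`
is symmetric as a product of commuting skew operators, so `Γ x` is the skew part of `L x`. -/
lemma IsChernOperation.of_torsion (hneg : ∀ x y, Γ (-x) y = -Γ x y)
    (hg : ∀ x y z, h.metric (Γ x y) z + h.metric y (Γ x z) = 0)
    (hJ : ∀ x y, Γ x (h.J y) = h.J (Γ x y))
    (hT : ∀ x y, Γ (h.J x) (h.J y) - Γ (h.J y) (h.J x) - ⁅h.J x, h.J y⁆ =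
      -(Γ x y - Γ y x - ⁅x, y⁆)) : h.IsChernOperation Γ := by
  have hneg' : ∀ x y, Γ x (-y) = -Γ x y := fun x y => by rw [← h.J_J y, hJ, hJ, h.J_J]
  have hM : ∀ x y, Γ x y + h.J (Γ (h.J x) y) = ⁅x, y⁆ + h.J ⁅h.J x, y⁆ := by
    intro x y
    have h1 := hT x y
    have h2 := congrArg h.J (hT (h.J x) y)
    rw [h.lie_J_J] at h1
    simp only [h.J_J, hJ, hneg, hneg', map_sub, map_neg, map_add, neg_lie] at h1 h2
    have h3 : (2 : ℝ) • (Γ x y + h.J (Γ (h.J x) y)) = (2 : ℝ) • (⁅x, y⁆ + h.J ⁅h.J x, y⁆) := by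
      linear_combination (norm := module) h1 + h2
    exact smul_right_injective 𝔤 (two_ne_zero (α := ℝ)) h3
  intro x y z
  rw [← hM, ← hM, map_add, map_add, LinearMap.add_apply]
  have h1 := hg x y z
  have h2 := hg (h.J x) (h.J y) z
  rw [hJ, h.metric_J_left y] at h2
  linarith

namespace IsChernOperation

lemma metric_skew (hΓ : h.IsChernOperation Γ) (x y z : 𝔤) :
    h.metric (Γ x y) z = -h.metric y (Γ x z) := by
  have h1 := hΓ x y z
  have h2 := hΓ x z y
  rw [h.metric_symm y (Γ x z)]
  rw [h.metric_symm z, h.metric_symm _ y] at h2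
  rw [h.metric_symm y] at h2
  linarith [h.metric_symm y (⁅x, z⁆ + h.J ⁅h.J x, z⁆)]

lemma neg_left (hΓ : h.IsChernOperation Γ) (x y : 𝔤) : Γ (-x) y = -Γ x y := by
  refine h.metric_ext fun z => ?_
  have h1 := hΓ x y z
  have h2 := hΓ (-x) y z
  simp only [neg_lie, map_neg, ← neg_add, LinearMap.neg_apply] at h2 ⊢
  linarith

lemma neg_right (hΓ : h.IsChernOperation Γ) (x y : 𝔤) : Γ x (-y) = -Γ x y := by
  refine h.metric_ext fun z => ?_
  have h1 := hΓ x y z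
  have h2 := hΓ x (-y) z
  simp only [lie_neg, map_neg, ← neg_add, LinearMap.neg_apply] at h2 ⊢
  linarith

lemma curvature_swap (hΓ : h.IsChernOperation Γ) (x y z : 𝔤) :
    operationCurvature Γ x y z = -operationCurvature Γ y x z := by
  rw [operationCurvature, operationCurvature, ← lie_skew x y, hΓ.neg_left]
  abel

lemma curvature_neg_left (hΓ : h.IsChernOperation Γ) (x y z : 𝔤) :
    operationCurvature Γ (-x) y z = -operationCurvature Γ x y z := by
  simp only [operationCurvature, hΓ.neg_left, hΓ.neg_right, neg_lie]
  abel

lemma metric_curvature_skew (hΓ : h.IsChernOperation Γ) (x y z w : 𝔤) :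
    h.metric (operationCurvature Γ x y z) w =
    -h.metric (operationCurvature Γ x y w) z := by
  rw [h.metric_symm _ z]
  simp only [operationCurvature, map_sub, LinearMap.sub_apply, hΓ.metric_skew, neg_neg]
  ring

/-- Both pairs of arguments are skew, and each contributes a factor `2 √-1`, whence the constant
`-4`. -/
lemma complexExtend_curvature (hΓ : h.IsChernOperation Γ) (x w : 𝔤) :
    complexExtend₄ (fun u v w z => h.metric (operationCurvature Γ u v w) z)
      (x, -h.J x) (x, h.J x) (w, -h.J w) (w, h.J w) =
      ((-4 * h.metric (operationCurvature Γ x (h.J x) w) (h.J w) : ℝ) : ℂ) := by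
  have hself : ∀ u a b, h.metric (operationCurvature Γ u u a) b = 0 := by
    intro u a b
    have := congrArg (fun v => h.metric v b) (hΓ.curvature_swap u u a)
    simp only [map_neg, LinearMap.neg_apply] at this
    linarith
  have hself' : ∀ u v a, h.metric (operationCurvature Γ u v a) a = 0 := by
    intro u v a
    linarith [hΓ.metric_curvature_skew u v a a]
  have hneg : ∀ u v a b, h.metric (operationCurvature Γ u v (-a)) b =
      -h.metric (operationCurvature Γ u v a) b := by
    intro u v a b
    rw [hΓ.metric_curvature_skew, map_neg, hΓ.metric_curvature_skew u v b a,
      neg_neg]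
  have hswap : ∀ u v a b, h.metric (operationCurvature Γ u v a) b =
      -h.metric (operationCurvature Γ v u a) b := by
    intro u v a b
    rw [hΓ.curvature_swap, map_neg, LinearMap.neg_apply]
  simp only [complexExtend₄, complexExtend₂, complexExtend, hΓ.curvature_neg_left, map_neg,
    LinearMap.neg_apply, hneg, hself, hself', hswap (h.J x) x,
    hΓ.metric_curvature_skew _ _ (h.J w) w]
  push_cast
  ring_nf
  rw [Complex.I_sq]
  ring

end IsChernOperation

lemma complexExtend_metric (h : HermitianStructure 𝔤) (x w : 𝔤) :
    complexExtend₂ (fun u v => h.metric u v) (x, -h.J x) (w, h.J w) =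
      2 * (h.metric x w : ℂ) + 2 * Complex.I * (h.metric x (h.J w) : ℂ) := by
  simp only [complexExtend₂, complexExtend, map_neg, LinearMap.neg_apply, h.metric_J,
    h.metric_J_left x w]
  push_cast
  ring_nf
  rw [Complex.I_sq]
  ring

end HermitianStructure

end ChernOperation

/-! ### From the Lie group to its Lie algebra -/

section LeftInvariant

variable {E : Type*} [NormedAddCommGroup E] [NormedSpace ℝ E]
  {G : Type*} [TopologicalSpace G] [ChartedSpace E G] [Group G]

lemma maurerCartan_neg (x : G) (u : TangentSpace 𝓘(ℝ, E) x) :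
    maurerCartan x (-u) = -maurerCartan x u :=
  map_neg _ _

lemma maurerCartan_sub (x : G) (u v : TangentSpace 𝓘(ℝ, E) x) :
    maurerCartan x (u - v) = maurerCartan x u - maurerCartan x v :=
  map_sub _ _ _

lemma mulInvariantVectorField_neg (v : GroupLieAlgebra 𝓘(ℝ, E) G) (x : G) :
    mulInvariantVectorField (-v) x = -mulInvariantVectorField v x :=
  map_neg (mfderiv 𝓘(ℝ, E) 𝓘(ℝ, E) (fun y : G => x * y) (1 : G)) v

variable [LieGroup 𝓘(ℝ, E) ∞ G]

lemma isInvertible_mfderiv_mul_left (x y : G) :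
    (mfderiv 𝓘(ℝ, E) 𝓘(ℝ, E) (fun z : G => x * z) y).IsInvertible := by
  have hd : ∀ a b : G, MDifferentiableAt 𝓘(ℝ, E) 𝓘(ℝ, E) (fun z : G => a * z) b := fun a b =>
    (contMDiff_mul_left (I := 𝓘(ℝ, E)) (n := ∞)).contMDiffAt.mdifferentiableAt (by simp)
  have h1 : mfderiv 𝓘(ℝ, E) 𝓘(ℝ, E) ((fun z : G => x⁻¹ * z) ∘ fun z => x * z) y =
      ContinuousLinearMap.id ℝ (TangentSpace 𝓘(ℝ, E) y) := by
    have : (fun z : G => x⁻¹ * z) ∘ (fun z => x * z) = id := by ext z; simp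
    rw [this, id_eq, mfderiv_id]
  rw [mfderiv_comp (I' := 𝓘(ℝ, E)) _ (hd _ _) (hd _ _)] at h1
  have h2 : mfderiv 𝓘(ℝ, E) 𝓘(ℝ, E) ((fun z : G => x * z) ∘ fun z => x⁻¹ * z) (x * y) =
      ContinuousLinearMap.id ℝ (TangentSpace 𝓘(ℝ, E) (x * y)) := by
    have : (fun z : G => x * z) ∘ (fun z => x⁻¹ * z) = id := by ext z; simp
    rw [this, id_eq, mfderiv_id]
  rw [mfderiv_comp (I' := 𝓘(ℝ, E)) _ (hd _ _) (hd _ _), inv_mul_cancel_left x y] at h2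
  exact ContinuousLinearMap.IsInvertible.of_inverse h2 h1

lemma maurerCartan_mulInvariantVectorField (x : G) (v : GroupLieAlgebra 𝓘(ℝ, E) G) :
    maurerCartan x (mulInvariantVectorField v x) = v := by
  have hinv := isInvertible_mfderiv_mul_left (E := E) x 1
  rw [mul_one] at hinv
  exact hinv.inverse_apply_eq.2 rfl

lemma mulInvariantVectorField_maurerCartan (x : G) (u : TangentSpace 𝓘(ℝ, E) x) :
    mulInvariantVectorField (maurerCartan x u) x = u := by
  have hinv := isInvertible_mfderiv_mul_left (E := E) x 1
  rw [mul_one] at hinv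
  exact (hinv.inverse_apply_eq.1 rfl).symm

variable [CompleteSpace E]

namespace HermitianStructure

variable (h : HermitianStructure (GroupLieAlgebra 𝓘(ℝ, E) G))

lemma leftJ_mulInvariantVectorField (v : GroupLieAlgebra 𝓘(ℝ, E) G) (x : G) :
    h.leftJ x (mulInvariantVectorField v x) = mulInvariantVectorField (h.J v) x := by
  rw [leftJ, maurerCartan_mulInvariantVectorField]

lemma leftMetric_mulInvariantVectorField (u v : GroupLieAlgebra 𝓘(ℝ, E) G) (x : G) :
    h.leftMetric x (mulInvariantVectorField u x) (mulInvariantVectorField v x) =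
      h.metric u v := by
  rw [leftMetric, maurerCartan_mulInvariantVectorField, maurerCartan_mulInvariantVectorField]

lemma complexMetric_eq (x : G)
    (a b : GroupLieAlgebra 𝓘(ℝ, E) G) :
    h.complexMetric x (mulInvariantVectorField a x, -mulInvariantVectorField (h.J a) x)
      (conjVector (mulInvariantVectorField b x, -mulInvariantVectorField (h.J b) x)) =
      2 * (h.metric a b : ℂ) + 2 * Complex.I * (h.metric a (h.J b) : ℂ) := by
  rw [← complexExtend_metric]
  simp only [complexMetric, complexExtend₂, complexExtend, conjVector, leftMetric,
    maurerCartan_neg, maurerCartan_mulInvariantVectorField, neg_neg]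

variable [FiniteDimensional ℝ E]
  (D : CovariantDerivative 𝓘(ℝ, E) E (TangentSpace 𝓘(ℝ, E) : G → Type _))

/-- The covariant derivative of left-invariant vector fields at the point `x`. -/
noncomputable def leftConnection (x : G) (u v : GroupLieAlgebra 𝓘(ℝ, E) G) :
    GroupLieAlgebra 𝓘(ℝ, E) G :=
  maurerCartan x (D (mulInvariantVectorField v) x (mulInvariantVectorField u x))

variable {h D}

lemma IsChernConnection.isChernOperation (hD : h.IsChernConnection D) (x : G) :
    h.IsChernOperation (leftConnection D x) := by
  refine IsChernOperation.of_torsion ?_ ?_ ?_ ?_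
  · intro u v
    rw [leftConnection, leftConnection, mulInvariantVectorField_neg, map_neg, maurerCartan_neg]
  · intro u v w
    have := hD.metric_parallel _ _ x (mdifferentiableAt_mulInvariantVectorField v)
      (mdifferentiableAt_mulInvariantVectorField w) (mulInvariantVectorField u x)
    simp only [leftMetric_mulInvariantVectorField] at this
    simp only [leftMetric, maurerCartan_mulInvariantVectorField] at this
    rw [leftConnection, leftConnection, ← this]
    simp [mvfderiv]
  · intro u v
    have := hD.J_parallel _ x (mdifferentiableAt_mulInvariantVectorField v)
      (mulInvariantVectorField u x)
    simp only [leftJ_mulInvariantVectorField] at this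
    rw [leftConnection, this, leftJ, maurerCartan_mulInvariantVectorField, leftConnection]
  · intro u v
    have key : ∀ a b : GroupLieAlgebra 𝓘(ℝ, E) G,
        maurerCartan x (D.torsion x (mulInvariantVectorField a x) (mulInvariantVectorField b x)) =
          leftConnection D x a b - leftConnection D x b a - ⁅a, b⁆ := by
      intro a b
      rw [D.torsion_apply (mdifferentiableAt_mulInvariantVectorField a)
        (mdifferentiableAt_mulInvariantVectorField b), maurerCartan_sub, maurerCartan_sub,
        ← mulInvariantVector_mlieBracket, maurerCartan_mulInvariantVectorField]
      rfl
    have := congrArg (maurerCartan x)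
      (hD.torsion_J_J x (mulInvariantVectorField u x) (mulInvariantVectorField v x))
    rw [leftJ_mulInvariantVectorField, leftJ_mulInvariantVectorField, key, maurerCartan_neg,
      key] at this
    exact this

/-- The operation obtained at each point satisfies the same Koszul-type formula, which determines
it; hence it is the one at the identity, and covariant derivatives of left-invariant fields are
left-invariant. -/
lemma IsChernConnection.apply_mulInvariantVectorField (hD : h.IsChernConnection D)
    (u v : GroupLieAlgebra 𝓘(ℝ, E) G) (x : G) :
    D (mulInvariantVectorField v) x (mulInvariantVectorField u x) =
      mulInvariantVectorField (leftConnection D 1 u v) x := by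
  rw [(hD.isChernOperation 1).eq (hD.isChernOperation x), leftConnection,
    mulInvariantVectorField_maurerCartan]

lemma IsChernConnection.curvatureOnFields_eq (hD : h.IsChernConnection D)
    (u v w : GroupLieAlgebra 𝓘(ℝ, E) G) (x : G) :
    maurerCartan x (curvatureOnFields D (mulInvariantVectorField u) (mulInvariantVectorField v)
      (mulInvariantVectorField w) x) = operationCurvature (leftConnection D 1) u v w := by
  rw [curvatureOnFields, ← mulInvariantVector_mlieBracket]
  simp only [hD.apply_mulInvariantVectorField, maurerCartan_sub,
    maurerCartan_mulInvariantVectorField]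
  rfl

lemma IsChernConnection.curvatureTensor_eq (hD : h.IsChernConnection D) (x : G)
    (u v w z : TangentSpace 𝓘(ℝ, E) x) :
    h.curvatureTensor D x u v w z = h.metric (operationCurvature (leftConnection D 1)
      (maurerCartan x u) (maurerCartan x v) (maurerCartan x w)) (maurerCartan x z) := by
  rw [curvatureTensor, leftMetric, hD.curvatureOnFields_eq]

lemma IsChernConnection.complexCurvature_eq (hD : h.IsChernConnection D) (x : G)
    (a b : GroupLieAlgebra 𝓘(ℝ, E) G)
    {X Y : TangentSpace 𝓘(ℝ, E) x × TangentSpace 𝓘(ℝ, E) x}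
    (hX : X = (mulInvariantVectorField a x, -mulInvariantVectorField (h.J a) x))
    (hY : Y = (mulInvariantVectorField b x, -mulInvariantVectorField (h.J b) x)) :
    h.complexCurvature D x X (conjVector X) Y (conjVector Y) =
      ((-4 * h.metric (operationCurvature (leftConnection D 1) a (h.J a) b) (h.J b) : ℝ) : ℂ) := by
  rw [← (hD.isChernOperation 1).complexExtend_curvature]
  simp only [complexCurvature, complexExtend₄, complexExtend₂, complexExtend, conjVector, hX, hY,
    hD.curvatureTensor_eq, maurerCartan_neg, maurerCartan_mulInvariantVectorField, neg_neg]

end HermitianStructure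

end LeftInvariant

/-! ### The main theorem -/

theorem mainTheorem1 {E : Type*} [NormedAddCommGroup E] [NormedSpace ℝ E]
    [CompleteSpace E] [FiniteDimensional ℝ E]
    {G : Type*} [TopologicalSpace G] [ChartedSpace E G] [Group G] [LieGroup 𝓘(ℝ, E) ∞ G]
    (n : ℕ) (hn : 0 < n) (hdim : Module.finrank ℝ E = 2 * n)
    (Γ : Subgroup G) [DiscreteTopology Γ] [CompactSpace (Quotient (MulAction.orbitRel Γ G))]
    (h : HermitianStructure (GroupLieAlgebra 𝓘(ℝ, E) G))
    (hcases :
      LieRing.IsNilpotent (GroupLieAlgebra 𝓘(ℝ, E) G) ∨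
      (LieAlgebra.IsSolvable (GroupLieAlgebra 𝓘(ℝ, E) G) ∧ h.HasComplexCommutator) ∨
      (IsUnimodularLieAlgebra (GroupLieAlgebra 𝓘(ℝ, E) G) ∧
        IsAlmostAbelian (GroupLieAlgebra 𝓘(ℝ, E) G)) ∨
      (IsUnimodularLieAlgebra (GroupLieAlgebra 𝓘(ℝ, E) G) ∧
        h.HasComplexAbelianIdealOfCodimTwo))
    (D : CovariantDerivative 𝓘(ℝ, E) E (TangentSpace 𝓘(ℝ, E) : G → Type _))
    (hD : h.IsChernConnection D)
    (α β : ℝ) (hαβ : (α, β) ≠ (0, 0)) (c : ℝ)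
    (hc : h.HasConstantMixedCurvature D n α β c) :
    c = 0 ∧ (β ≠ 0 → h.IsFlat D) := by
  have hfin : FiniteDimensional ℝ (GroupLieAlgebra 𝓘(ℝ, E) G) :=
    inferInstanceAs (FiniteDimensional ℝ E)
  have key := h.rigid hn (show Module.finrank ℝ (GroupLieAlgebra 𝓘(ℝ, E) G) = 2 * n from hdim)
    hcases (hD.isChernOperation 1) (α := α) (β := β) (c := c) (by
      intro u hu huJ x hx
      have hskew : ∀ y, h.metric y (h.J y) = 0 := fun y => by
        have := h.metric_J_left y y
        rw [h.metric_symm] at this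
        linarith
      have hunit : h.complexMetric 1 (mulInvariantVectorField x 1,
          -mulInvariantVectorField (h.J x) 1) (conjVector (mulInvariantVectorField x 1,
            -mulInvariantVectorField (h.J x) 1)) = 1 := by
        rw [h.complexMetric_eq, hx, hskew]
        norm_num
      -- Evaluating at the identity suffices: there the hypothesis already gives the algebraic
      -- identity, and flatness at other points follows from left-invariance.
      have := hc 1 (fun i => (mulInvariantVectorField (u i) 1,
          -mulInvariantVectorField (h.J (u i)) 1))
        ⟨fun i => by rw [HermitianStructure.IsTypeOneZero, h.leftJ_mulInvariantVectorField],
          fun i j => by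
            rw [h.complexMetric_eq, hu, huJ]
            split_ifs <;> norm_num⟩
        (mulInvariantVectorField x 1, -mulInvariantVectorField (h.J x) 1)
        (by rw [HermitianStructure.IsTypeOneZero, h.leftJ_mulInvariantVectorField]) hunit
      rw [HermitianStructure.holomorphicSectionalCurvature, hunit, one_pow, div_one,
        hD.complexCurvature_eq 1 x x rfl rfl, HermitianStructure.ricci,
        Finset.sum_congr rfl fun i _ => hD.complexCurvature_eq 1 x (u i) rfl rfl] at this
      rw [Finset.mul_sum]
      exact_mod_cast this)
  refine ⟨key.1, fun hβ x u v w z => ?_⟩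
  rw [hD.curvatureTensor_eq, key.2 hβ, map_zero, LinearMap.zero_apply]
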